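/- Let $q$ be a complex number with $0<|q|<1$. Write $(u;q)_k=\prod_{j=0}^{k-1}(1-uq^j)$ and $(u;q)_{-k}=\prod_{j=1}^{k}(1-uq^{-j})^{-1}$ for integers $k\ge 0$, and $${}_{r+1}\phi_r\left[\begin{matrix}a_1,\dots,a_{r+1}\\ b_1,\dots,b_r\end{matrix};q,x\right]=\sum_{i\ge 0}\frac{(a_1;q)_i\cdots(a_{r+1};q)_i}{(b_1;q)_i\cdots(b_r;q)_i}\frac{x^i}{(q;q)_i}.$$ Let $n,s\ge 0$ be integers, let $\mathbf k=(k_1,\dots,k_s)$ be positive integers with $|\mathbf k|=k_1+\dots+k_s$, and let $w$ and $z_1,\dots,z_s$ be nonzero complex numbers, the $z_l$ pairwise distinct, such that no denominator below vanishes (the ${}_{2s+2}\phi_{2s+1}$ terminates, its terms of index $i>n$ being $0$). Then \begin{multline*} \frac{(qw^2;q^2)_n}{(w^2;q)_n}\, \prod_{l=1}^s \frac{(q^{-k_l}w/z_l;q)_n}{(w/z_l;q)_n}\; {}_{2s+2}\phi_{2s+1}\left[\begin{matrix} w^2/q,\ q^{-n},\ \{w/z_l,\ q^{k_l}wz_l\}_{1\le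 l\le s}\\ q^nw^2,\ \{wz_l,\ q^{-k_l}w/z_l\}_{1\le l\le s}\end{matrix};q,-q^{n-|\mathbf k|+1}\right]\\ =q^{-\binom{|\mathbf k|}{2}}\,(-q;q)_{n-|\mathbf k|}\, \prod_{1\le a<b\le s}\frac{(q^{k_b+1}z_az_b;q)_{k_a}}{(qz_az_b;q)_{k_a}}\, \prod_{a=1}^s\frac{(qz_a^2;q^2)_{k_a}}{(qz_a^2;q)_{k_a}}\\ \times\sum_{\mathbf m\le\mathbf k}(-1)^{|\mathbf m|}\,c_{\mathbf m}\,q^{(|\mathbf k|-n)|\mathbf m|}\, \prod_{l=1}^s\frac{(q^nwz_l;q)_{m_l}}{(wz_l;q)_{m_l}}\,\frac{(qz_l/w;q)_{m_l}}{(q^{1-n}z_l/w;q)_{m_l}}, \end{multline*} where the sum is over all $\mathbf m=(m_1,\dots,m_s)\in\mathbb{Z}_{\ge 0}^s$ with $m_l\le k_l$ for all $l$, $|\mathbf m|=m_1+\dots+m_s$, and $$c_{\mathbf m}=\prod_{1\le a<b\le s}\frac{q^{m_a}z_a-q^{m_b}z_b}{z_a-z_b}\, \prod_{1\le a\le b\le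 s}\frac{1-q^{m_a+m_b}z_az_b}{1-z_az_b}\, \prod_{a,b=1}^s\frac{(q^{-k_b}z_a/z_b;q)_{m_a}}{(qz_a/z_b;q)_{m_a}}\,\frac{(z_az_b;q)_{m_a}}{(q^{1+k_b}z_az_b;q)_{m_a}}.$$ -/

import Mathlib

open scoped BigOperators

/-- The `q`-shifted factorial `(a; q)_k = (1 - a) (1 - a q) ⋯ (1 - a q ^ (k - 1))`, `k : ℕ`. -/
noncomputable def qPoch (a q : ℂ) (k : ℕ) : ℂ :=
  ∏ j ∈ Finset.range k, (1 - a * q ^ j)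

/-- The `q`-shifted factorial `(a; q)_k` for an integer `k`; for negative index
`(a; q)_{-k} = 1 / ((1 - a q ^ (-1)) (1 - a q ^ (-2)) ⋯ (1 - a q ^ (-k)))`. For `0 < |q| < 1`
this is `(a; q)_∞ / (a q ^ k; q)_∞` in both cases, whenever that quotient is defined. -/
noncomputable def qPochInt (a q : ℂ) : ℤ → ℂ
  | Int.ofNat k => qPoch a q k
  | Int.negSucc k => (∏ j ∈ Finset.range (k + 1), (1 - a * q ^ (-((j : ℤ) + 1))))⁻¹

/-- The `i`-th term of the series `_{r+1}φ_r [a; b; q, x]`. -/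
noncomputable def phiTerm {r : ℕ} (a : Fin (r + 1) → ℂ) (b : Fin r → ℂ) (q x : ℂ) (i : ℕ) : ℂ :=
  (∏ j, qPoch (a j) q i) / (∏ j, qPoch (b j) q i) * (x ^ i / qPoch q q i)

/-- The basic hypergeometric series `_{r+1}φ_r [a; b; q, x]`. -/
noncomputable def phi {r : ℕ} (a : Fin (r + 1) → ℂ) (b : Fin r → ℂ) (q x : ℂ) : ℂ :=
  ∑' i : ℕ, phiTerm a b q x i

/-- The upper parameters `w²/q, q^{-n}, {w/z_l, q^{k_l} w z_l}` (there are `2 s + 2` of them). -/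
noncomputable def upperParams {s : ℕ} (n : ℕ) (k : Fin s → ℕ) (q w : ℂ) (z : Fin s → ℂ) :
    Fin (s + s + 1 + 1) → ℂ :=
  Fin.cons (w ^ 2 / q) (Fin.cons (q ^ (-(n : ℤ)))
    (Fin.append (fun l => w / z l) (fun l => q ^ k l * w * z l)))

/-- The lower parameters `q^n w², {w z_l, q^{-k_l} w/z_l}` (there are `2 s + 1` of them). -/
noncomputable def lowerParams {s : ℕ} (n : ℕ) (k : Fin s → ℕ) (q w : ℂ) (z : Fin s → ℂ) :
    Fin (s + s + 1) → ℂ :=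
  Fin.cons (q ^ n * w ^ 2)
    (Fin.append (fun l => w * z l) (fun l => q ^ (-(k l : ℤ)) * w / z l))

/-- The coefficient `c_m` of the `C_s` basic hypergeometric sum. -/
noncomputable def cCoeff {s : ℕ} (k : Fin s → ℕ) (q : ℂ) (z : Fin s → ℂ) (m : Fin s → ℕ) : ℂ :=
  (∏ a, ∏ b ∈ Finset.Ioi a, (q ^ m a * z a - q ^ m b * z b) / (z a - z b)) *
  (∏ a, ∏ b ∈ Finset.Ici a, (1 - q ^ (m a + m b) * z a * z b) / (1 - z a * z b)) *
  (∏ a, ∏ b,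
    qPoch (q ^ (-(k b : ℤ)) * z a / z b) q (m a) / qPoch (q * z a / z b) q (m a) *
    (qPoch (z a * z b) q (m a) / qPoch (q ^ (1 + k b) * z a * z b) q (m a)))

/-! Write ξ_i for `latticePoint q w i` and c(y) = y + 1/(qy). Since w(ξ_i - c(y)) = q^{-i}(1 - q^i w
y)(1 - q^i w/(qy)), the factors that z_l contributes to the left side combine into a polynomial in
ξ_i with roots c(z_l q^j), j < k_l (`qPoch_ratio_eq`). The left side is thus a constant times
`baileyFunctional`, applied to a product of linear factors ξ - c(y_t).

For generic y_t, `baileyFunctional_prod` evaluates this as a sum over signs attached to the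
variables. Multiplication by ξ - ξ_0 turns the functional for (n, w) into a multiple of the one for
(n - 1, qw), so the splitting ξ - c(y_u) = (ξ - ξ_0) + (ξ_0 - c(y_u)) peels off one factor; the
empty product is the Bailey–Daum sum. The sign sum obeys the same recursion (`typeCSum_insert`):
both sides are polynomials in α of degree at most |T| + 1, and at the 2|T| nodes α = 1/y_t and α = q
y_t the sign of t is forced, which leaves a smaller set.

At y = z_l q^j a pair weight vanishes unless, for each l, the sign `true` occupies an initial
segment of the j. The sign sum becomes a sum over m ≤ k (`signSum_segmentSet`), whose weights
telescope to q-shifted factorials (`prod_signWeight_segments`, `prod_pointWeight_eq`). -/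

/-! ### Products over ordered pairs. -/

section PairProducts

variable {ι : Type*} [LinearOrder ι]

/-- The product of `g a b` over the pairs `a < b` of elements of `T`. -/
noncomputable def pairProd (T : Finset ι) (g : ι → ι → ℂ) : ℂ :=
  ∏ a ∈ T, ∏ b ∈ T, if a < b then g a b else 1

theorem pairProd_congr {T : Finset ι} {g h : ι → ι → ℂ}
    (H : ∀ a ∈ T, ∀ b ∈ T, a < b → g a b = h a b) : pairProd T g = pairProd T h := by
  unfold pairProd
  refine Finset.prod_congr rfl fun a ha => Finset.prod_congr rfl fun b hb => ?_
  split_ifs with hab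
  · exact H a ha b hb hab
  · rfl

/-- Symmetry of `g` makes the position of `t` in the order irrelevant. -/
theorem pairProd_insert {T : Finset ι} {t : ι} (ht : t ∉ T) {g : ι → ι → ℂ}
    (hg : ∀ a b, g a b = g b a) :
    pairProd (insert t T) g = (∏ a ∈ T, g a t) * pairProd T g := by
  unfold pairProd
  rw [Finset.prod_insert ht, Finset.prod_insert ht]
  simp only [lt_irrefl, if_false, one_mul]
  have h1 : ∀ a ∈ T, (∏ b ∈ insert t T, if a < b then g a b else 1) =
      (if a < t then g a t else 1) * ∏ b ∈ T, if a < b then g a b else 1 :=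
    fun a _ => Finset.prod_insert ht
  rw [Finset.prod_congr rfl h1, Finset.prod_mul_distrib, ← mul_assoc, ← Finset.prod_mul_distrib]
  congr 1
  refine Finset.prod_congr rfl fun a ha => ?_
  have hat : a ≠ t := fun h => ht (h ▸ ha)
  rcases lt_or_gt_of_ne hat with h | h
  · simp [h, h.not_gt]
  · simp [h, h.not_gt, hg t a]

end PairProducts

/-! ### Sums over sign choices with pair weights. -/

/-- The pair weight attached to two variables `x`, `y` with signs `σ`, `τ`. -/
noncomputable def signWeight (q : ℂ) : Bool → ℂ → Bool → ℂ → ℂ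
  | true, x, true, y => q * (1 - x * y) / (1 - q * x * y)
  | true, x, false, y => (x - q * y) / (x - y)
  | false, x, true, y => (y - q * x) / (y - x)
  | false, x, false, y => (1 - q ^ 2 * x * y) / (1 - q * x * y)

theorem signWeight_comm (q : ℂ) (σ τ : Bool) (x y : ℂ) :
    signWeight q σ x τ y = signWeight q τ y σ x := by
  cases σ <;> cases τ <;> simp only [signWeight] <;> ring_nf

section SignSums

variable {ι : Type*} [LinearOrder ι]

/-- The sum over all sign choices on `T`, encoded as subsets of `T`, of the product of the
one-point weights `f` and of the pair weights. -/
noncomputable def signSum (q : ℂ) (y : ι → ℂ) (T : Finset ι) (f : Bool → ι → ℂ) : ℂ :=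
  ∑ S ∈ T.powerset, (∏ p ∈ T, f (decide (p ∈ S)) p) *
    pairProd T fun a b => signWeight q (decide (a ∈ S)) (y a) (decide (b ∈ S)) (y b)

theorem signSum_empty (q : ℂ) (y : ι → ℂ) (f : Bool → ι → ℂ) : signSum q y ∅ f = 1 := by
  simp [signSum, pairProd]

theorem signSum_congr {q : ℂ} {y : ι → ℂ} {T : Finset ι} {f g : Bool → ι → ℂ}
    (h : ∀ p ∈ T, ∀ σ, f σ p = g σ p) : signSum q y T f = signSum q y T g := by
  unfold signSum
  refine Finset.sum_congr rfl fun S _ => ?_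
  rw [Finset.prod_congr rfl fun p hp => h p hp _]

theorem signSum_const_mul (q : ℂ) (y : ι → ℂ) (T : Finset ι) (f : Bool → ι → ℂ) (c : ℂ) :
    signSum q y T (fun σ p => c * f σ p) = c ^ T.card * signSum q y T f := by
  unfold signSum
  rw [Finset.mul_sum]
  refine Finset.sum_congr rfl fun S _ => ?_
  rw [Finset.prod_mul_distrib, Finset.prod_const, mul_assoc]

/-- Once the sign of `t` is fixed, its pair weights depend on one other variable each and are
absorbed into the one-point weights; this is why `f` is arbitrary. -/
theorem signSum_insert (q : ℂ) (y : ι → ℂ) {T : Finset ι} {t : ι} (ht : t ∉ T)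
    (f : Bool → ι → ℂ) :
    signSum q y (insert t T) f =
      f false t * signSum q y T (fun σ p => f σ p * signWeight q σ (y p) false (y t)) +
      f true t * signSum q y T (fun σ p => f σ p * signWeight q σ (y p) true (y t)) := by
  unfold signSum
  rw [Finset.sum_powerset_insert ht, Finset.mul_sum, Finset.mul_sum]
  congr 1
  · refine Finset.sum_congr rfl fun S hS => ?_
    have htS : t ∉ S := fun h => ht (Finset.mem_powerset.1 hS h)
    rw [pairProd_insert ht fun a b => signWeight_comm _ _ _ _ _, Finset.prod_insert ht,
      Finset.prod_mul_distrib]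
    simp only [htS, decide_false]
    ring
  · refine Finset.sum_congr rfl fun S hS => ?_
    rw [pairProd_insert ht fun a b => signWeight_comm _ _ _ _ _, Finset.prod_insert ht,
      Finset.prod_mul_distrib]
    have hmem : ∀ p ∈ T, decide (p ∈ insert t S) = decide (p ∈ S) := by
      intro p hp
      have : p ≠ t := fun h => ht (h ▸ hp)
      simp [this]
    have h1 : ∏ p ∈ T, f (decide (p ∈ insert t S)) p = ∏ p ∈ T, f (decide (p ∈ S)) p :=
      Finset.prod_congr rfl fun p hp => by rw [hmem p hp]
    have h2 : ∏ a ∈ T, signWeight q (decide (a ∈ insert t S)) (y a)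
          (decide (t ∈ insert t S)) (y t) =
        ∏ a ∈ T, signWeight q (decide (a ∈ S)) (y a) true (y t) :=
      Finset.prod_congr rfl fun p hp => by
        rw [hmem p hp]
        simp
    rw [h1, h2, pairProd_congr fun a ha b hb _ => by rw [hmem a ha, hmem b hb]]
    simp only [Finset.mem_insert_self, decide_true]
    ring

end SignSums

/-! ### The C-type sum and its recursion in the number of variables. -/

/-- The one-point weights of the `C`-type sum. -/
noncomputable def pointWeight (q α β : ℂ) : Bool → ℂ → ℂ
  | true, y => (1 - α * y) * (1 - β * y)
  | false, y => q⁻¹ * ((α - q * y) * (β - q * y))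

/-- The variables `y p`, `p ∈ T`, are nonzero and in general position. -/
structure Generic {ι : Type*} (q : ℂ) (y : ι → ℂ) (T : Finset ι) : Prop where
  ne_zero : ∀ a ∈ T, y a ≠ 0
  injOn : ∀ a ∈ T, ∀ b ∈ T, a ≠ b → y a ≠ y b
  one_sub_ne : ∀ a ∈ T, ∀ b ∈ T, 1 - q * y a * y b ≠ 0

theorem Generic.mono {ι : Type*} {q : ℂ} {y : ι → ℂ} {S T : Finset ι} (h : Generic q y T) (hST : S ⊆ T) :
    Generic q y S :=
  ⟨fun a ha => h.ne_zero a (hST ha), fun a ha b hb => h.injOn a (hST ha) b (hST hb),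
    fun a ha b hb => h.one_sub_ne a (hST ha) b (hST hb)⟩

section Recursion

variable {ι : Type*} [LinearOrder ι]

/-- The `C`-type sum over signs, with one-point weights `pointWeight q α β`. -/
noncomputable def typeCSum (q : ℂ) (y : ι → ℂ) (T : Finset ι) (α β : ℂ) : ℂ :=
  signSum q y T fun σ p => pointWeight q α β σ (y p)

/-- At α = 1/y_t the weight of t with sign `true` vanishes. With sign `false`, the pair weights of t
cancel against the α-factors of the other variables, which amounts to a factor q each and to
replacing α by α/q. -/
theorem typeCSum_insert_inv {q : ℂ} (hq : q ≠ 0) {y : ι → ℂ} {T : Finset ι} {t : ι} (ht : t ∉ T)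
    (h : Generic q y (insert t T)) (β : ℂ) :
    typeCSum q y (insert t T) (y t)⁻¹ β =
      q⁻¹ * (((y t)⁻¹ - q * y t) * (β - q * y t)) * (q ^ T.card *
        typeCSum q y T ((y t)⁻¹ / q) β) := by
  have hyt : y t ≠ 0 := h.ne_zero t (Finset.mem_insert_self _ _)
  unfold typeCSum
  rw [signSum_insert q y ht, ← signSum_const_mul]
  simp only [pointWeight, inv_mul_cancel₀ hyt, sub_self, zero_mul, add_zero]
  congr 1
  refine signSum_congr fun p hp σ => ?_
  have hpt : p ≠ t := fun e => ht (e ▸ hp)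
  have h1 := sub_ne_zero.2
    (h.injOn p (Finset.mem_insert_of_mem hp) t (Finset.mem_insert_self _ _) hpt)
  have h2 := h.one_sub_ne p (Finset.mem_insert_of_mem hp) t (Finset.mem_insert_self _ _)
  have h2' := h.one_sub_ne t (Finset.mem_insert_self _ _) p (Finset.mem_insert_of_mem hp)
  cases σ
  · simp only [signWeight]
    field_simp
  · simp only [signWeight]
    field_simp
    ring

/-- The mirror case: at α = q y_t the sign `false` is excluded, and α again becomes α/q. -/
theorem typeCSum_insert_mul {q : ℂ} (hq : q ≠ 0) {y : ι → ℂ} {T : Finset ι} {t : ι} (ht : t ∉ T)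
    (h : Generic q y (insert t T)) (β : ℂ) :
    typeCSum q y (insert t T) (q * y t) β =
      (1 - q * y t * y t) * (1 - β * y t) * (q ^ T.card * typeCSum q y T (y t) β) := by
  have hyt : y t ≠ 0 := h.ne_zero t (Finset.mem_insert_self _ _)
  unfold typeCSum
  rw [signSum_insert q y ht, ← signSum_const_mul]
  simp only [pointWeight, sub_self, zero_mul, mul_zero, zero_add]
  congr 1
  refine signSum_congr fun p hp σ => ?_
  have hpt : p ≠ t := fun e => ht (e ▸ hp)
  have h1 := sub_ne_zero.2
    (h.injOn p (Finset.mem_insert_of_mem hp) t (Finset.mem_insert_self _ _) hpt)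
  have h1' := sub_ne_zero.2
    (h.injOn t (Finset.mem_insert_self _ _) p (Finset.mem_insert_of_mem hp) hpt.symm)
  have h2 := h.one_sub_ne p (Finset.mem_insert_of_mem hp) t (Finset.mem_insert_self _ _)
  have h2' := h.one_sub_ne t (Finset.mem_insert_self _ _) p (Finset.mem_insert_of_mem hp)
  cases σ
  · simp only [signWeight]
    field_simp
  · simp only [signWeight]
    field_simp

-- Each one-point weight is linear in α and the pair weights do not involve α.
open Polynomial in
theorem exists_polynomial_typeCSum (q : ℂ) (y : ι → ℂ) (T : Finset ι) (β : ℂ) :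
    ∃ P : ℂ[X], P.natDegree ≤ T.card ∧ ∀ α, P.eval α = typeCSum q y T α β := by
  classical
  let F : Bool → ι → ℂ[X] := fun σ p =>
    if σ then C (1 - β * y p) * (1 - C (y p) * X) else C (q⁻¹ * (β - q * y p)) * (X - C (q * y p))
  have hF : ∀ σ p, (F σ p).natDegree ≤ 1 := by
    intro σ p
    cases σ
    · simp only [F, Bool.false_eq_true, if_false]
      compute_degree
    · simp only [F, if_true]
      compute_degree
  refine ⟨∑ S ∈ T.powerset, (∏ p ∈ T, F (decide (p ∈ S)) p) * C (pairProd T fun a b =>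
    signWeight q (decide (a ∈ S)) (y a) (decide (b ∈ S)) (y b)), ?_, fun α => ?_⟩
  · refine natDegree_sum_le_of_forall_le _ _ fun S _ => ?_
    refine (natDegree_mul_C_le _ _).trans ((natDegree_prod_le _ _).trans ?_)
    exact (Finset.sum_le_sum fun p _ => hF _ p).trans (by simp)
  · unfold typeCSum signSum
    rw [eval_finsetSum]
    refine Finset.sum_congr rfl fun S _ => ?_
    rw [eval_mul, eval_C, eval_prod]
    congr 1
    refine Finset.prod_congr rfl fun p _ => ?_
    cases decide (p ∈ S)
    · simp [F, pointWeight]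
      ring
    · simp [F, pointWeight]
      ring

-- The case |T| = 1 of `typeCSum_insert`, out of reach of interpolation, is checked by expanding all
-- four sign choices.
set_option maxRecDepth 4000 in
theorem typeCSum_pair_recursion {q : ℂ} (hq : q ≠ 0) {y : ι → ℂ} {t u : ι} (htu : t ≠ u)
    (h : Generic q y (insert u {t})) (α : ℂ) {β : ℂ} (hβ : β ≠ 0) :
    typeCSum q y (insert u {t}) α β = q * ((1 - α * β / q) * y u * (q / β - β) *
        typeCSum q y {t} α (β / q) +
      (β - q * y u) * (1 - β * y u) / β * (1 + α * β / q ^ 2) * typeCSum q y {t} α β) := by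
  have h1 := sub_ne_zero.2 (h.injOn t (by simp) u (by simp) htu)
  have h1' := sub_ne_zero.2 (h.injOn u (by simp) t (by simp) htu.symm)
  have h2 := h.one_sub_ne t (by simp) u (by simp)
  have hut : u ∉ ({t} : Finset ι) := by simpa using htu.symm
  unfold typeCSum
  rw [signSum_insert q y hut, ← insert_empty_eq t]
  simp only [signSum_insert q y (Finset.notMem_empty t), signSum_empty, pointWeight, signWeight]
  generalize y t = a at *
  generalize y u = b at *
  have h2' : 1 - q * b * a ≠ 0 := by rwa [mul_right_comm]
  have e : (b - q * a) / (b - a) = (q * a - b) / (a - b) := by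
    rw [div_eq_div_iff h1' h1]
    ring
  rw [e]
  clear e h1'
  field_simp
  ring

open Polynomial in
/-- Peeling off one variable from the `C`-type sum. -/
theorem typeCSum_insert {q : ℂ} (hq : q ≠ 0) {y : ι → ℂ} {T : Finset ι} {u : ι} (hu : u ∉ T)
    (h : Generic q y (insert u T)) (α : ℂ) {β : ℂ} (hβ : β ≠ 0) :
    typeCSum q y (insert u T) α β = q ^ T.card * ((1 - α * β / q) * y u * (q / β - β) *
        typeCSum q y T α (β / q) +
      (β - q * y u) * (1 - β * y u) / β * (1 + α * β / q ^ (T.card + 1)) *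
        typeCSum q y T α β) := by
  classical
  induction hn : T.card using Nat.strong_induction_on generalizing T α with
  | _ n ih =>
  subst hn
  -- Interpolation needs 2|T| > |T| + 1, that is |T| ≥ 2; smaller sets are treated directly.
  rcases Nat.lt_or_ge T.card 2 with hT | hT
  · interval_cases hc : T.card
    · obtain rfl := Finset.card_eq_zero.1 hc
      unfold typeCSum
      rw [signSum_insert q y hu]
      simp only [signSum_empty, pointWeight]
      field_simp
      ring
    · obtain ⟨t, rfl⟩ := Finset.card_eq_one.1 hc
      have htu : t ≠ u := by simpa [eq_comm] using hu
      simpa using typeCSum_pair_recursion hq htu h α hβ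
  · obtain ⟨P, hPd, hP⟩ := exists_polynomial_typeCSum q y (insert u T) β
    obtain ⟨Q, hQd, hQ⟩ := exists_polynomial_typeCSum q y T (β / q)
    obtain ⟨R, hRd, hR⟩ := exists_polynomial_typeCSum q y T β
    set N := T.card with hN
    set P' : ℂ[X] := C (q ^ N * (y u * (q / β - β))) * ((1 - C (β / q) * X) * Q) +
      C (q ^ N * ((β - q * y u) * (1 - β * y u) / β)) * ((1 + C (β / q ^ (N + 1)) * X) * R)
      with hP'
    have hP'e : ∀ α, P'.eval α = q ^ N * ((1 - α * β / q) * y u * (q / β - β) *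
        typeCSum q y T α (β / q) +
      (β - q * y u) * (1 - β * y u) / β * (1 + α * β / q ^ (N + 1)) *
        typeCSum q y T α β) := by
      intro α
      simp only [hP', eval_add, eval_mul, eval_C, eval_sub, eval_one, eval_X, hQ, hR]
      ring
    have hlin1 : (1 - C (β / q) * X : ℂ[X]).natDegree ≤ 1 := by compute_degree
    have hlin2 : (1 + C (β / q ^ (N + 1)) * X : ℂ[X]).natDegree ≤ 1 := by compute_degree
    have hP'd : P'.natDegree ≤ N + 1 := by
      refine natDegree_add_le_of_degree_le ?_ ?_
      · refine (natDegree_C_mul_le _ _).trans (natDegree_mul_le.trans ?_)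
        omega
      · refine (natDegree_C_mul_le _ _).trans (natDegree_mul_le.trans ?_)
        omega
    rw [Finset.card_insert_of_notMem hu, ← hN] at hPd
    have hgT : Generic q y T := h.mono (Finset.subset_insert _ _)
    -- the two families of interpolation nodes
    have key : ∀ t ∈ T, P.eval (y t)⁻¹ = P'.eval (y t)⁻¹ ∧ P.eval (q * y t) = P'.eval (q * y t) := by
      intro t ht
      have hyt : y t ≠ 0 := hgT.ne_zero t ht
      have htu : t ≠ u := fun e => hu (e ▸ ht)
      have hTe : insert t (T.erase t) = T := Finset.insert_erase ht
      have hcard : (T.erase t).card = N - 1 := Finset.card_erase_of_mem ht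
      have hte : t ∉ T.erase t := Finset.notMem_erase _ _
      have hue : u ∉ T.erase t := fun e => hu (Finset.mem_of_mem_erase e)
      have hsw : insert u T = insert t (insert u (T.erase t)) := by
        rw [Finset.insert_comm, hTe]
      have htue : t ∉ insert u (T.erase t) := by
        simp [htu]
      have hcard2 : (insert u (T.erase t)).card = N := by
        rw [Finset.card_insert_of_notMem hue, hcard]
        omega
      have hg2 : Generic q y (insert u (T.erase t)) :=
        h.mono (Finset.insert_subset_insert _ (Finset.erase_subset _ _))
      -- The induction hypothesis is needed at the shifted value α/q produced by specializing α at a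
      -- node.
      have IH := fun α => ih (N - 1) (by omega) (T := T.erase t) hue hg2 α hcard
      have hg3 : Generic q y (insert t (insert u (T.erase t))) := hsw ▸ h
      have hg4 : Generic q y (insert t (T.erase t)) := hTe.symm ▸ hgT
      obtain ⟨M, hM⟩ : ∃ M, N = M + 1 := ⟨N - 1, by omega⟩
      rw [hP, hP, hP'e, hP'e]
      constructor
      · have e1 := typeCSum_insert_inv hq htue hg3 β
        have e2 := typeCSum_insert_inv hq hte hg4 β
        have e3 := typeCSum_insert_inv hq hte hg4 (β / q)
        rw [← hsw, hcard2, IH] at e1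
        rw [hTe, hcard] at e2 e3
        rw [e1, e2, e3, hM]
        simp only [Nat.add_sub_cancel]
        generalize typeCSum q y (T.erase t) ((y t)⁻¹ / q) (β / q) = G1
        generalize typeCSum q y (T.erase t) ((y t)⁻¹ / q) β = G2
        field_simp
        ring
      · have e1 := typeCSum_insert_mul hq htue hg3 β
        have e2 := typeCSum_insert_mul hq hte hg4 β
        have e3 := typeCSum_insert_mul hq hte hg4 (β / q)
        rw [← hsw, hcard2, IH] at e1
        rw [hTe, hcard] at e2 e3
        rw [e1, e2, e3, hM]
        simp only [Nat.add_sub_cancel]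
        generalize typeCSum q y (T.erase t) (y t) (β / q) = G1
        generalize typeCSum q y (T.erase t) (y t) β = G2
        field_simp
        ring
    have hPP : P = P' := by
      set Z : Finset ℂ := T.image (fun t => (y t)⁻¹) ∪ T.image (fun t => q * y t) with hZ
      have hinj : Set.InjOn y T := fun a ha b hb e => by
        by_contra hab
        exact hgT.injOn a ha b hb hab e
      have hZc : Z.card = N + N := by
        rw [hZ, Finset.card_union_of_disjoint, Finset.card_image_of_injOn,
          Finset.card_image_of_injOn]
        · exact fun a ha b hb e => hinj ha hb (mul_left_cancel₀ hq e)
        · exact fun a ha b hb e => hinj ha hb (inv_injective e)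
        -- A node 1/y_a equal to a node q y_b would give 1 - q y_b y_a = 0.
        · rw [Finset.disjoint_left]
          intro x hx hx'
          obtain ⟨a, ha, rfl⟩ := Finset.mem_image.1 hx
          obtain ⟨b, hb, e⟩ := Finset.mem_image.1 hx'
          apply hgT.one_sub_ne b hb a ha
          rw [e, inv_mul_cancel₀ (hgT.ne_zero a ha), sub_self]
      refine eq_of_natDegree_lt_card_of_eval_eq' P P' Z ?_ ?_
      · intro x hx
        rcases Finset.mem_union.1 hx with hx | hx
        · obtain ⟨a, ha, rfl⟩ := Finset.mem_image.1 hx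
          exact (key a ha).1
        · obtain ⟨a, ha, rfl⟩ := Finset.mem_image.1 hx
          exact (key a ha).2
      · rw [hZc]
        have := max_le hPd hP'd
        omega
    rw [← hP, hPP, hP'e]

end Recursion

/-! ### q-shifted factorials: recurrences and nonvanishing. -/

section Pochhammer

theorem qPoch_succ (a q : ℂ) (k : ℕ) : qPoch a q (k + 1) = qPoch a q k * (1 - a * q ^ k) :=
  Finset.prod_range_succ _ _

theorem qPoch_succ' (a q : ℂ) (k : ℕ) : qPoch a q (k + 1) = (1 - a) * qPoch (a * q) q k := by
  unfold qPoch
  rw [Finset.prod_range_succ', mul_comm]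
  congr 1
  · simp
  · exact Finset.prod_congr rfl fun j _ => by ring

theorem one_sub_mul_qPoch (a q : ℂ) (k : ℕ) :
    (1 - a) * qPoch (a * q) q k = qPoch a q k * (1 - a * q ^ k) := by
  rw [← qPoch_succ', qPoch_succ]

theorem qPoch_ne_zero_iff {a q : ℂ} {k : ℕ} :
    qPoch a q k ≠ 0 ↔ ∀ j < k, 1 - a * q ^ j ≠ 0 := by
  simp [qPoch, Finset.prod_ne_zero_iff]

theorem one_sub_pow_ne_zero {q : ℂ} (hq1 : ‖q‖ < 1) {k : ℕ} (hk : k ≠ 0) : 1 - q ^ k ≠ 0 := by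
  intro h
  have h1 : ‖q ^ k‖ = 1 := by rw [← sub_eq_zero.1 h, norm_one]
  rw [norm_pow] at h1
  exact (pow_lt_one₀ (norm_nonneg q) hq1 hk).ne h1

theorem one_add_pow_ne_zero {q : ℂ} (hq1 : ‖q‖ < 1) (k : ℕ) : 1 + q ^ k ≠ 0 := by
  rcases eq_or_ne k 0 with rfl | hk
  · norm_num
  · intro h
    have h1 : ‖q ^ k‖ = 1 := by
      rw [show q ^ k = -1 by linear_combination h, norm_neg, norm_one]
    rw [norm_pow] at h1
    exact (pow_lt_one₀ (norm_nonneg q) hq1 hk).ne h1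

theorem one_add_zpow_ne_zero {q : ℂ} (hq0 : q ≠ 0) (hq1 : ‖q‖ < 1) (k : ℤ) : 1 + q ^ k ≠ 0 := by
  obtain ⟨m, rfl | rfl⟩ := k.eq_nat_or_neg
  · simpa using one_add_pow_ne_zero hq1 m
  · rw [zpow_neg, zpow_natCast]
    have h := one_add_pow_ne_zero hq1 m
    have h0 : q ^ m ≠ 0 := pow_ne_zero _ hq0
    intro e
    apply h
    field_simp at e
    linear_combination e

/-- The recurrence crosses index 0 without exception because 1 + q^j never vanishes when 0 < |q| <
1. Negative indices occur as soon as |k| > n. -/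
theorem qPochInt_neg_succ {q : ℂ} (hq0 : q ≠ 0) (hq1 : ‖q‖ < 1) (N : ℤ) :
    qPochInt (-q) q (N + 1) = qPochInt (-q) q N * (1 + q ^ (N + 1)) := by
  obtain k | k := N
  · have : (Int.ofNat k + 1 : ℤ) = Int.ofNat (k + 1) := rfl
    rw [this]
    simp only [qPochInt, qPoch_succ]
    congr 1
    simp only [Int.ofNat_eq_natCast, zpow_natCast]
    ring
  · have h1 : (1 : ℂ) - -q * q ^ (-((k : ℤ) + 1)) = 1 + q ^ (Int.negSucc k + 1) := by
      rw [Int.negSucc_eq, show -((k : ℤ) + 1) + 1 = 1 + -((k : ℤ) + 1) by ring, zpow_add₀ hq0,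
        zpow_one]
      ring
    have h2 := one_add_zpow_ne_zero hq0 hq1 (Int.negSucc k + 1)
    simp only [qPochInt]
    rw [Finset.prod_range_succ, h1, mul_inv, mul_assoc, inv_mul_cancel₀ h2, mul_one]
    cases k with
    | zero => simp [qPoch]
    | succ k =>
      have : (Int.negSucc (k + 1) + 1 : ℤ) = Int.negSucc k := rfl
      rw [this]

end Pochhammer

/-! ### The Bailey–Daum functional and its value on products of linear factors. -/

section BaileyDaum

/-- The summand of the terminating Bailey–Daum series. -/
noncomputable def baileyTerm (q w : ℂ) (n i : ℕ) : ℂ :=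
  qPoch (w ^ 2 / q) q i * qPoch (q ^ (-(n : ℤ))) q i /
    (qPoch q q i * qPoch (q ^ n * w ^ 2) q i) * (-q ^ (n + 1)) ^ i

/-- The point of the quadratic lattice attached to the index `i`. -/
noncomputable def latticePoint (q w : ℂ) (i : ℕ) : ℂ := q ^ i * w / q + (q ^ i * w)⁻¹

/-- The normalized discrete functional defined by the Bailey–Daum weight. -/
noncomputable def baileyFunctional (q w : ℂ) (n : ℕ) (P : ℂ → ℂ) : ℂ :=
  qPoch (q * w ^ 2) (q ^ 2) n / qPoch (w ^ 2) q n *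
    ∑ i ∈ Finset.range (n + 1), baileyTerm q w n i * P (latticePoint q w i)

theorem latticePoint_succ (q w : ℂ) (i : ℕ) :
    latticePoint q w (i + 1) = latticePoint q (q * w) i := by
  unfold latticePoint
  ring_nf

variable {q w : ℂ}

/-- The difference ξ_{i+1} - ξ_0 factors through (1 - q^{i+1})(1 - w² q^i). The first factor cancels
the last one of (q;q)_{i+1}, the second turns (w²;q)_i into a multiple of (qw²;q)_i, the value
belonging to qw. -/
theorem baileyTerm_succ (hq0 : q ≠ 0) (hq1 : ‖q‖ < 1) (hw : w ≠ 0) (n i : ℕ) :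
    baileyTerm q w (n + 1) (i + 1) * (latticePoint q w (i + 1) - latticePoint q w 0) =
      (1 - w ^ 2 / q) * (1 - w ^ 2) * (1 - q ^ (n + 1)) / (w * (1 - q ^ (n + 1) * w ^ 2)) *
        baileyTerm q (q * w) n i := by
  have hi := one_sub_pow_ne_zero hq1 (Nat.succ_ne_zero i)
  have e1 : latticePoint q w (i + 1) - latticePoint q w 0 =
      (q ^ (i + 1) * w)⁻¹ * (1 - q ^ (i + 1)) * (1 - w ^ 2 * q ^ i) := by
    unfold latticePoint
    field_simp
    ring
  have e2 : qPoch (w ^ 2 / q) q (i + 1) = (1 - w ^ 2 / q) * qPoch (w ^ 2) q i := by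
    rw [qPoch_succ', div_mul_cancel₀ _ hq0]
  have e3 : qPoch (q ^ (-((n + 1 : ℕ) : ℤ))) q (i + 1) =
      (1 - q ^ (-((n + 1 : ℕ) : ℤ))) * qPoch (q ^ (-(n : ℤ))) q i := by
    rw [qPoch_succ', ← zpow_add_one₀ hq0]
    congr 3
    push_cast
    ring
  have e4 : qPoch q q (i + 1) = qPoch q q i * (1 - q ^ (i + 1)) := by
    rw [qPoch_succ, pow_succ']
  have e5 : qPoch (q ^ (n + 1) * w ^ 2) q (i + 1) =
      (1 - q ^ (n + 1) * w ^ 2) * qPoch (q ^ n * (q * w) ^ 2) q i := by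
    rw [qPoch_succ']
    congr 2
    ring
  have e6 : qPoch (w ^ 2) q i * (1 - w ^ 2 * q ^ i) =
      (1 - w ^ 2) * qPoch ((q * w) ^ 2 / q) q i := by
    rw [← one_sub_mul_qPoch]
    congr 2
    field_simp
  have e7 : (1 - q ^ (-((n + 1 : ℕ) : ℤ))) = -(1 - q ^ (n + 1)) / q ^ (n + 1) := by
    rw [zpow_neg, zpow_natCast]
    field_simp
    ring
  unfold baileyTerm
  rw [e1, e2, e3, e4, e5, e7]
  have e8 : (-q ^ (n + 1 + 1)) ^ (i + 1) =
      -q ^ (n + 1 + 1) * q ^ i * (-q ^ (n + 1)) ^ i := by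
    rw [show (-q ^ (n + 1 + 1)) = -q ^ (n + 1) * q by ring, mul_pow, pow_succ (-q ^ (n + 1))]
    ring
  rw [e8]
  calc _ = (1 - w ^ 2 / q) * (qPoch (w ^ 2) q i * (1 - w ^ 2 * q ^ i)) *
        (-(1 - q ^ (n + 1)) / q ^ (n + 1) * qPoch (q ^ (-(n : ℤ))) q i) /
        (qPoch q q i * (1 - q ^ (i + 1)) *
          ((1 - q ^ (n + 1) * w ^ 2) * qPoch (q ^ n * (q * w) ^ 2) q i)) *
        (-q ^ (n + 1 + 1) * q ^ i * (-q ^ (n + 1)) ^ i) *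
        ((q ^ (i + 1) * w)⁻¹ * (1 - q ^ (i + 1))) := by
        generalize 1 - w ^ 2 * q ^ i = A
        generalize 1 - q ^ (i + 1) = B
        generalize 1 - q ^ (n + 1) * w ^ 2 = D
        ring
    _ = _ := by
        rw [e6]
        generalize qPoch (q ^ (-(n : ℤ))) q i = A
        generalize qPoch (q ^ n * (q * w) ^ 2) q i = B
        generalize qPoch q q i = D
        generalize (-q ^ (n + 1)) ^ i = F
        generalize 1 - q ^ (n + 1) * w ^ 2 = H
        generalize 1 - q ^ (n + 1) = N
        rw [Nat.succ_eq_add_one] at hi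
        generalize 1 - q ^ (i + 1) = J at *
        field_simp
        ring

/-- Here ξ_i - ξ_{n+1} factors through (1 - q^{n+1-i})(1 - w² q^{n+i}), which are the factors by
which (q^{-n-1};q)_i and (q^{n+1}w²;q)_i differ from their analogues for n. -/
theorem baileyTerm_pred (hq0 : q ≠ 0) (hq1 : ‖q‖ < 1) (hw : w ≠ 0) {n i : ℕ} (hi : i ≤ n)
    (h0 : 1 - w ^ 2 * q ^ n ≠ 0) (hni : 1 - w ^ 2 * q ^ (n + i) ≠ 0) :
    baileyTerm q w (n + 1) i * (latticePoint q w i - latticePoint q w (n + 1)) =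
      (1 - (q ^ (n + 1))⁻¹) * (1 - w ^ 2 * q ^ n) / w * baileyTerm q w n i := by
  obtain ⟨d, rfl⟩ := Nat.exists_eq_add_of_le hi
  have hd := one_sub_pow_ne_zero hq1 (Nat.succ_ne_zero d)
  have e1 : latticePoint q w i - latticePoint q w (i + d + 1) =
      -(q ^ (i + d + 1) * w)⁻¹ * (1 - q ^ (d + 1)) * (1 - w ^ 2 * q ^ (i + d + i)) := by
    unfold latticePoint
    field_simp
    ring
  have e2 : qPoch (q ^ (-((i + d + 1 : ℕ) : ℤ))) q i * (1 - (q ^ (d + 1))⁻¹) =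
      (1 - (q ^ (i + d + 1))⁻¹) * qPoch (q ^ (-((i + d : ℕ) : ℤ))) q i := by
    have h := one_sub_mul_qPoch (q ^ (-((i + d + 1 : ℕ) : ℤ))) q i
    rw [← zpow_add_one₀ hq0, show -((i + d + 1 : ℕ) : ℤ) + 1 = -((i + d : ℕ) : ℤ) by push_cast; ring,
      ← zpow_natCast q i, ← zpow_add₀ hq0, show -((i + d + 1 : ℕ) : ℤ) + (i : ℤ) = -((d + 1 : ℕ) : ℤ)
        by push_cast; ring, zpow_neg q ((d + 1 : ℕ) : ℤ), zpow_natCast] at h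
    rw [← h, zpow_neg, zpow_natCast]
  have e3 : qPoch (q ^ (i + d) * w ^ 2) q i * (1 - w ^ 2 * q ^ (i + d + i)) =
      (1 - w ^ 2 * q ^ (i + d)) * qPoch (q ^ (i + d + 1) * w ^ 2) q i := by
    have h := one_sub_mul_qPoch (q ^ (i + d) * w ^ 2) q i
    rw [show q ^ (i + d) * w ^ 2 * q = q ^ (i + d + 1) * w ^ 2 by ring,
      show q ^ (i + d) * w ^ 2 * q ^ i = w ^ 2 * q ^ (i + d + i) by ring] at h
    rw [← h]
    ring
  have e4 : (1 - (q ^ (d + 1))⁻¹) = -(1 - q ^ (d + 1)) / q ^ (d + 1) := by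
    field_simp
    ring
  have hd2 : (1 - (q ^ (d + 1))⁻¹) ≠ 0 := by
    rw [e4]
    exact div_ne_zero (neg_ne_zero.2 hd) (pow_ne_zero _ hq0)
  have e5 : qPoch (q ^ (-((i + d + 1 : ℕ) : ℤ))) q i =
      (1 - (q ^ (i + d + 1))⁻¹) * qPoch (q ^ (-((i + d : ℕ) : ℤ))) q i /
        (1 - (q ^ (d + 1))⁻¹) := by
    rw [← e2, mul_div_cancel_right₀ _ hd2]
  have e6 : qPoch (q ^ (i + d + 1) * w ^ 2) q i =
      qPoch (q ^ (i + d) * w ^ 2) q i * (1 - w ^ 2 * q ^ (i + d + i)) /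
        (1 - w ^ 2 * q ^ (i + d)) := by
    rw [e3, mul_div_cancel_left₀ _ h0]
  have e7 : (-q ^ (i + d + 1 + 1)) ^ i = (-q ^ (i + d + 1)) ^ i * q ^ i := by
    rw [← mul_pow]
    ring
  unfold baileyTerm
  rw [e1, e5, e6, e7, e4]
  generalize qPoch (q ^ (-((i + d : ℕ) : ℤ))) q i = A
  generalize qPoch (w ^ 2 / q) q i = B
  generalize qPoch q q i = D
  generalize qPoch (q ^ (i + d) * w ^ 2) q i = E
  generalize (-q ^ (i + d + 1)) ^ i = F
  generalize (1 - (q ^ (i + d + 1))⁻¹) = H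
  have hx : q ^ (i + d + 1) = q ^ i * q ^ (d + 1) := by ring
  rw [hx]
  generalize 1 - q ^ (d + 1) = J at *
  generalize 1 - w ^ 2 * q ^ (i + d + i) = M at *
  generalize 1 - w ^ 2 * q ^ (i + d) = N at *
  field_simp

theorem baileyFunctional_add (P Q : ℂ → ℂ) (n : ℕ) :
    baileyFunctional q w n (fun ξ => P ξ + Q ξ) =
      baileyFunctional q w n P + baileyFunctional q w n Q := by
  simp only [baileyFunctional, mul_add, Finset.sum_add_distrib]

theorem baileyFunctional_const_mul (P : ℂ → ℂ) (c : ℂ) (n : ℕ) :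
    baileyFunctional q w n (fun ξ => c * P ξ) = c * baileyFunctional q w n P := by
  simp only [baileyFunctional]
  rw [mul_left_comm, Finset.mul_sum _ _ c]
  congr 1
  exact Finset.sum_congr rfl fun i _ => by ring

/-- The factor ξ - ξ_0 kills the term i = 0, and reindexing the others gives the functional for (n,
qw). The range j < 2(n + 1) covers the zeros of both (w²;q)_{n+1} and (q^{n+1}w²;q)_{n+1}. -/
theorem baileyFunctional_shift (hq0 : q ≠ 0) (hq1 : ‖q‖ < 1) (hw : w ≠ 0) {n : ℕ}
    (h : ∀ j < 2 * (n + 1), 1 - w ^ 2 * q ^ j ≠ 0) (P : ℂ → ℂ) :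
    baileyFunctional q w (n + 1) (fun ξ => (ξ - latticePoint q w 0) * P ξ) =
      (1 - q ^ (n + 1)) * (1 - w ^ 2 / q) / w * baileyFunctional q (q * w) n P := by
  unfold baileyFunctional
  rw [Finset.sum_range_succ']
  simp only [sub_self, zero_mul, mul_zero, add_zero, ← mul_assoc]
  rw [Finset.sum_congr rfl fun i _ => by
    rw [baileyTerm_succ hq0 hq1 hw, mul_assoc, latticePoint_succ], ← Finset.mul_sum]
  simp only [← mul_assoc]
  congr 1
  have h0 : 1 - w ^ 2 ≠ 0 := by simpa using h 0 (by omega)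
  have h1 : 1 - w ^ 2 * q ≠ 0 := by simpa using h 1 (by omega)
  have hn := h (n + 1) (by omega)
  have e1 : qPoch (w ^ 2) q (n + 1) * (1 - q ^ (n + 1) * w ^ 2) =
      (1 - w ^ 2) * ((1 - w ^ 2 * q) * qPoch ((q * w) ^ 2) q n) := by
    rw [qPoch_succ', mul_assoc, show (q * w) ^ 2 = w ^ 2 * q * q by ring, one_sub_mul_qPoch]
    ring
  have e2 : qPoch (q * w ^ 2) (q ^ 2) (n + 1) =
      (1 - w ^ 2 * q) * qPoch (q * (q * w) ^ 2) (q ^ 2) n := by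
    rw [qPoch_succ']
    congr 2
    · ring
    · ring
  have e3 : qPoch (q * w ^ 2) (q ^ 2) (n + 1) / qPoch (w ^ 2) q (n + 1) *
      ((1 - w ^ 2 / q) * (1 - w ^ 2) * (1 - q ^ (n + 1)) / (w * (1 - q ^ (n + 1) * w ^ 2))) =
      qPoch (q * w ^ 2) (q ^ 2) (n + 1) *
      ((1 - w ^ 2 / q) * (1 - w ^ 2) * (1 - q ^ (n + 1))) /
        (w * (qPoch (w ^ 2) q (n + 1) * (1 - q ^ (n + 1) * w ^ 2))) := by
    rw [div_mul_div_comm]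
    ring
  rw [e3, e1, e2]
  field_simp

/-- Killing the last term instead lowers n and keeps w. Together with `baileyFunctional_shift` this
determines the functional at the constant 1. -/
theorem baileyFunctional_shift_last (hq0 : q ≠ 0) (hq1 : ‖q‖ < 1) (hw : w ≠ 0) {n : ℕ}
    (h : ∀ j < 2 * (n + 1), 1 - w ^ 2 * q ^ j ≠ 0) (P : ℂ → ℂ) :
    baileyFunctional q w (n + 1) (fun ξ => (ξ - latticePoint q w (n + 1)) * P ξ) =
      (1 - (q ^ (n + 1))⁻¹) * (1 - w ^ 2 * q ^ (2 * n + 1)) / w * baileyFunctional q w n P := by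
  unfold baileyFunctional
  rw [Finset.sum_range_succ]
  simp only [sub_self, zero_mul, mul_zero, add_zero, ← mul_assoc]
  have hn := h n (by omega)
  rw [Finset.sum_congr rfl fun i hi => by
    rw [baileyTerm_pred hq0 hq1 hw (Nat.lt_succ_iff.1 (Finset.mem_range.1 hi)) hn
      (h _ (by have := Finset.mem_range.1 hi; omega)), mul_assoc], ← Finset.mul_sum]
  simp only [← mul_assoc]
  congr 1
  rw [qPoch_succ, qPoch_succ, show q * w ^ 2 * (q ^ 2) ^ n = w ^ 2 * q ^ (2 * n + 1) by ring]
  field_simp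

/-- The terminating Bailey–Daum summation. -/
theorem baileyFunctional_one (hq0 : q ≠ 0) (hq1 : ‖q‖ < 1) (hw : w ≠ 0) {n : ℕ}
    (h : ∀ j < 2 * n, 1 - w ^ 2 * q ^ j ≠ 0) :
    baileyFunctional q w n (fun _ => 1) = qPoch (-q) q n := by
  induction n generalizing w with
  | zero => simp [baileyFunctional, baileyTerm, qPoch]
  | succ n ih =>
    have e1 := baileyFunctional_shift hq0 hq1 hw h (fun _ => 1)
    have e2 := baileyFunctional_shift_last hq0 hq1 hw h (fun _ => 1)
    rw [ih (mul_ne_zero hq0 hw) fun j hj => by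
      have := h (j + 2) (by omega)
      rwa [show (q * w) ^ 2 * q ^ j = w ^ 2 * q ^ (j + 2) by ring]] at e1
    rw [ih hw fun j hj => h j (by omega)] at e2
    have hlin : ∀ c : ℂ, baileyFunctional q w (n + 1) (fun ξ => (ξ - c) * 1) =
        baileyFunctional q w (n + 1) (fun ξ => ξ) -
          c * baileyFunctional q w (n + 1) (fun _ => 1) := by
      intro c
      simp only [baileyFunctional, mul_one, mul_sub, Finset.sum_sub_distrib, ← Finset.sum_mul]
      ring
    rw [hlin] at e1 e2
    have hn := one_sub_pow_ne_zero hq1 (Nat.succ_ne_zero n)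
    have hd : latticePoint q w (n + 1) - latticePoint q w 0 =
        (q ^ (n + 1) * w)⁻¹ * (1 - q ^ (n + 1)) * (1 - w ^ 2 * q ^ n) := by
      unfold latticePoint
      field_simp
      ring
    have hn2 := h n (by omega)
    have hne : latticePoint q w (n + 1) - latticePoint q w 0 ≠ 0 := by
      rw [hd]
      exact mul_ne_zero (mul_ne_zero (inv_ne_zero (mul_ne_zero (pow_ne_zero _ hq0) hw)) hn) hn2
    apply mul_left_cancel₀ hne
    -- Subtracting the two shift relations eliminates the unknown first moment.
    have e3 : (latticePoint q w (n + 1) - latticePoint q w 0) *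
        baileyFunctional q w (n + 1) (fun _ => 1) =
        (1 - q ^ (n + 1)) * (1 - w ^ 2 / q) / w * qPoch (-q) q n -
        (1 - (q ^ (n + 1))⁻¹) * (1 - w ^ 2 * q ^ (2 * n + 1)) / w * qPoch (-q) q n := by
      linear_combination e1 - e2
    rw [e3, hd, qPoch_succ]
    field_simp
    ring

variable {ι : Type*} [LinearOrder ι]

/-- The Bailey–Daum functional on products of linear factors is a `C`-type sum. -/
theorem baileyFunctional_prod (hq0 : q ≠ 0) (hq1 : ‖q‖ < 1) (hw : w ≠ 0) {n : ℕ}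
    (h : ∀ j < 2 * n, 1 - w ^ 2 * q ^ j ≠ 0) {y : ι → ℂ} {T : Finset ι} (hT : Generic q y T) :
    baileyFunctional q w n (fun ξ => ∏ t ∈ T, (ξ - (y t + (q * y t)⁻¹))) =
      (-1) ^ T.card * qPochInt (-q) q ((n : ℤ) - T.card) * (q ^ T.card.choose 2)⁻¹ *
        (∏ t ∈ T, (q * y t)⁻¹) * typeCSum q y T (q ^ n * w) (q / w) := by
  classical
  induction T using Finset.induction_on generalizing n w with
  | empty =>
    simp only [Finset.prod_empty, baileyFunctional_one hq0 hq1 hw h]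
    simp [typeCSum, signSum_empty, qPochInt]
  | insert u T hu ih =>
    have hgT : Generic q y T := hT.mono (Finset.subset_insert _ _)
    have hyu : y u ≠ 0 := hT.ne_zero u (Finset.mem_insert_self _ _)
    set c := y u + (q * y u)⁻¹ with hc
    set P : ℂ → ℂ := fun ξ => ∏ t ∈ T, (ξ - (y t + (q * y t)⁻¹)) with hP
    have e1 : (fun ξ => ∏ t ∈ insert u T, (ξ - (y t + (q * y t)⁻¹))) = fun ξ =>
        (ξ - latticePoint q w 0) * P ξ + (latticePoint q w 0 - c) * P ξ := by
      funext ξ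
      rw [Finset.prod_insert hu]
      simp only [hP, hc]
      ring
    have e2 : baileyFunctional q w n (fun ξ => (ξ - latticePoint q w 0) * P ξ) =
        (1 - q ^ n) * (1 - w ^ 2 / q) / w * ((-1) ^ T.card *
          qPochInt (-q) q ((n : ℤ) - (T.card + 1 : ℕ)) * (q ^ T.card.choose 2)⁻¹ *
          (∏ t ∈ T, (q * y t)⁻¹) * typeCSum q y T (q ^ n * w) (q / w / q)) := by
      cases n with
      -- For n = 0 only ξ_0 carries mass, and the right side has the factor 1 - q^0.
      | zero => simp [baileyFunctional]
      | succ n =>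
        rw [baileyFunctional_shift hq0 hq1 hw h, ih (mul_ne_zero hq0 hw) (fun j hj => by
          have := h (j + 2) (by omega)
          rwa [show (q * w) ^ 2 * q ^ j = w ^ 2 * q ^ (j + 2) by ring]) hgT]
        have a1 : ((n + 1 : ℕ) : ℤ) - (T.card + 1 : ℕ) = (n : ℤ) - T.card := by
          push_cast
          ring
        rw [a1, show q / (q * w) = q / w / q by field_simp,
          show q ^ n * (q * w) = q ^ (n + 1) * w by ring]
    have a2 : (n : ℤ) - T.card = (n : ℤ) - (T.card + 1 : ℕ) + 1 := by
      push_cast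
      ring
    -- With α = q^n w and β = q/w, the factor 1 + αβ/q^{|T|+1} of `typeCSum_insert` is 1 +
    -- q^{n-|T|}, exactly the step of `qPochInt (-q) q` from n - |T| - 1 to n - |T|.
    have a3 : q ^ ((n : ℤ) - (T.card + 1 : ℕ) + 1) = q ^ n / q ^ T.card := by
      rw [← a2, zpow_sub₀ hq0, zpow_natCast, zpow_natCast]
    rw [e1, baileyFunctional_add, baileyFunctional_const_mul, e2, ih hw h hgT, a2,
      qPochInt_neg_succ hq0 hq1, a3, typeCSum_insert hq0 hu hT _ (div_ne_zero hq0 hw),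
      Finset.card_insert_of_notMem hu, Finset.prod_insert hu, Nat.choose_succ_succ' T.card 1,
      Nat.choose_one_right, hc]
    generalize qPochInt (-q) q ((n : ℤ) - (T.card + 1 : ℕ)) = A
    generalize typeCSum q y T (q ^ n * w) (q / w / q) = B
    generalize typeCSum q y T (q ^ n * w) (q / w) = D
    generalize (∏ t ∈ T, (q * y t)⁻¹) = E
    simp only [latticePoint, pow_zero, pow_add]
    generalize T.card.choose 2 = m
    generalize T.card = N
    field_simp
    ring

end BaileyDaum

/-! ### Splitting, reversal and telescoping of q-shifted factorials. -/

section PochhammerAlgebra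

theorem qPoch_add (a q : ℂ) (m n : ℕ) :
    qPoch a q (m + n) = qPoch a q m * qPoch (a * q ^ m) q n := by
  unfold qPoch
  rw [Finset.prod_range_add]
  congr 1
  exact Finset.prod_congr rfl fun j _ => by ring

/-- Reversal of a finite `q`-shifted factorial. -/
theorem qPoch_reflect {a q : ℂ} (hq : q ≠ 0) (ha : a ≠ 0) (l : ℕ) :
    qPoch a q l = (∏ j ∈ Finset.range l, -(a * q ^ j)) *
      qPoch (q * (q ^ l)⁻¹ * a⁻¹) q l := by
  unfold qPoch
  rw [← Finset.prod_range_reflect (fun j => 1 - q * (q ^ l)⁻¹ * a⁻¹ * q ^ j),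
    ← Finset.prod_mul_distrib]
  refine Finset.prod_congr rfl fun j hj => ?_
  obtain ⟨d, rfl⟩ := Nat.exists_eq_add_of_lt (Finset.mem_range.1 hj)
  rw [show j + d + 1 - 1 - j = d by omega]
  field_simp
  ring

theorem prod_range_div_telescope {g : ℕ → ℂ} {N : ℕ} (h : ∀ j < N, g j ≠ 0) (h0 : g 0 ≠ 0) :
    ∏ j ∈ Finset.range N, g (j + 1) / g j = g N / g 0 := by
  induction N with
  | zero => simp [h0]
  | succ N ih =>
    rw [Finset.prod_range_succ, ih fun j hj => h j (by omega)]
    have := h N (by omega)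
    field_simp

theorem prod_range_div_telescope' {g : ℕ → ℂ} {N : ℕ} (h : ∀ j < N, g (j + 1) ≠ 0)
    (hN : g N ≠ 0) :
    ∏ j ∈ Finset.range N, g j / g (j + 1) = g 0 / g N := by
  cases N with
  | zero => simp [div_self hN]
  | succ N =>
    clear hN
    induction N with
    | zero => simp
    | succ N ih =>
      rw [Finset.prod_range_succ, ih fun j hj => h j (by omega)]
      have := h N (by omega)
      have := h (N + 1) (by omega)
      field_simp

/-- Reversal expresses the factors in 1/x through x; what remains is (q^{-l}x;q)_{l+m+1} split after
l factors and after m factors. It supplies the part of the cross block depending on the quotient of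
two variables. -/
theorem qPoch_cross {q x : ℂ} (hq : q ≠ 0) (hx : x ≠ 0) (m l : ℕ) :
    qPoch (q * x) q m * qPoch (q * x⁻¹) q l * (x - 1) =
      q ^ (m * l) * (qPoch ((q ^ l)⁻¹ * x) q m * qPoch ((q ^ m)⁻¹ * x⁻¹) q l) *
        (q ^ m * x - q ^ l) := by
  have e1 : qPoch (q * x⁻¹) q l =
      (∏ j ∈ Finset.range l, -(q * x⁻¹ * q ^ j)) * qPoch ((q ^ l)⁻¹ * x) q l := by
    rw [qPoch_reflect hq (mul_ne_zero hq (inv_ne_zero hx))]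
    congr 2
    field_simp
  have e2 : qPoch ((q ^ m)⁻¹ * x⁻¹) q l =
      (∏ j ∈ Finset.range l, -(q * x⁻¹ * q ^ j)) * (q ^ ((m + 1) * l))⁻¹ *
        qPoch (q ^ (m + 1) * (q ^ l)⁻¹ * x) q l := by
    rw [qPoch_reflect hq (mul_ne_zero (inv_ne_zero (pow_ne_zero _ hq)) (inv_ne_zero hx))]
    congr 1
    · have : ∀ j ∈ Finset.range l, -((q ^ m)⁻¹ * x⁻¹ * q ^ j) =
          -(q * x⁻¹ * q ^ j) * (q ^ (m + 1))⁻¹ := fun j _ => by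
        field_simp
        ring
      rw [Finset.prod_congr rfl this, Finset.prod_mul_distrib, Finset.prod_const,
        Finset.card_range, pow_mul, inv_pow]
    · congr 1
      field_simp
      ring
  have e3 : qPoch ((q ^ l)⁻¹ * x) q l * ((1 - x) * qPoch (q * x) q m) =
      qPoch ((q ^ l)⁻¹ * x) q m *
        ((1 - q ^ m * (q ^ l)⁻¹ * x) * qPoch (q ^ (m + 1) * (q ^ l)⁻¹ * x) q l) := by
    have h1 := qPoch_add ((q ^ l)⁻¹ * x) q l (m + 1)
    have h2 := qPoch_add ((q ^ l)⁻¹ * x) q m (l + 1)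
    rw [qPoch_succ'] at h1 h2
    rw [show l + (m + 1) = m + (l + 1) by ring, h2] at h1
    rw [show (q ^ l)⁻¹ * x * q ^ l = x by field_simp] at h1
    rw [show x * q = q * x by ring,
      show (q ^ l)⁻¹ * x * q ^ m = q ^ m * (q ^ l)⁻¹ * x by ring,
      show q ^ m * (q ^ l)⁻¹ * x * q = q ^ (m + 1) * (q ^ l)⁻¹ * x by ring] at h1
    exact h1.symm
  have e4 : q ^ m * x - q ^ l = -q ^ l * (1 - q ^ m * (q ^ l)⁻¹ * x) := by
    field_simp
    ring
  rw [e1, e2, e4, show q ^ ((m + 1) * l) = q ^ (m * l) * q ^ l by ring]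
  have : q ^ (m * l) ≠ 0 := pow_ne_zero _ hq
  have : q ^ l ≠ 0 := pow_ne_zero _ hq
  generalize qPoch (q ^ (m + 1) * (q ^ l)⁻¹ * x) q l = A at *
  generalize qPoch ((q ^ l)⁻¹ * x) q l = A₁ at *
  generalize qPoch ((q ^ l)⁻¹ * x) q m = A₂ at *
  generalize (∏ j ∈ Finset.range l, -(q * x⁻¹ * q ^ j)) = B at *
  generalize 1 - q ^ m * (q ^ l)⁻¹ * x = D at *
  generalize q ^ (m * l) = E at *
  field_simp
  linear_combination (-B) * e3

end PochhammerAlgebra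

/-! ### Pair weights within one geometric progression. -/

section SelfBlock

theorem pairProd_range_succ {g : ℕ → ℕ → ℂ} (hg : ∀ a b, g a b = g b a) (k : ℕ) :
    pairProd (Finset.range (k + 1)) g = (∏ i ∈ Finset.range k, g i k) *
      pairProd (Finset.range k) g := by
  rw [Finset.range_add_one, pairProd_insert Finset.notMem_range_self hg]

/-- The weights between a new last point and the earlier ones telescope in i. -/
theorem pairProd_signWeight_full {q z : ℂ} (m : ℕ)
    (hZ : ∀ j ≤ 2 * m, 1 - z * z * q ^ j ≠ 0) :
    pairProd (Finset.range m) (fun i j => signWeight q true (z * q ^ i) true (z * q ^ j)) =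
      q ^ m.choose 2 * qPoch (q * z ^ 2) (q ^ 2) m / qPoch (q ^ m * z ^ 2) q m := by
  induction m with
  | zero => simp [pairProd, qPoch]
  | succ m ih =>
    rw [pairProd_range_succ fun a b => signWeight_comm _ _ _ _ _,
      ih fun j hj => hZ j (by omega)]
    have e1 : ∏ i ∈ Finset.range m, signWeight q true (z * q ^ i) true (z * q ^ m) =
        q ^ m * ((1 - z * z * q ^ m) / (1 - z * z * q ^ (2 * m))) := by
      have h1 : ∀ i ∈ Finset.range m, signWeight q true (z * q ^ i) true (z * q ^ m) =
          q * ((fun i => 1 - z * z * q ^ (i + m)) i / (fun i => 1 - z * z * q ^ (i + m)) (i + 1)) :=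
        fun i _ => by
          simp only [signWeight]
          ring_nf
      rw [Finset.prod_congr rfl h1, Finset.prod_mul_distrib, prod_range_div_telescope'
        (g := fun i => 1 - z * z * q ^ (i + m))
        (fun j hj => hZ _ (by omega)) (hZ _ (by omega)), Finset.prod_const, Finset.card_range]
      ring_nf
    have hm := hZ m (by omega)
    have h2m := hZ (2 * m) (by omega)
    have h2m1 := hZ (2 * m + 1) (by omega)
    have hP : qPoch (q ^ m * z ^ 2) q m ≠ 0 := qPoch_ne_zero_iff.2 fun j hj => by
      have := hZ (m + j) (by omega)
      rwa [show q ^ m * z ^ 2 * q ^ j = z * z * q ^ (m + j) by ring]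
    have e2 : (1 - z * z * q ^ m) * qPoch (q ^ (m + 1) * z ^ 2) q (m + 1) =
        qPoch (q ^ m * z ^ 2) q m * (1 - z * z * q ^ (2 * m)) * (1 - z * z * q ^ (2 * m + 1)) := by
      have := qPoch_succ (q ^ m * z ^ 2) q (m + 1)
      rw [qPoch_succ', qPoch_succ (q ^ m * z ^ 2)] at this
      rw [show q ^ (m + 1) * z ^ 2 = q ^ m * z ^ 2 * q by ring,
        show z * z * q ^ m = q ^ m * z ^ 2 by ring, this]
      ring
    have e3 : qPoch (q ^ (m + 1) * z ^ 2) q (m + 1) =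
        qPoch (q ^ m * z ^ 2) q m * (1 - z * z * q ^ (2 * m)) * (1 - z * z * q ^ (2 * m + 1)) /
          (1 - z * z * q ^ m) := by
      rw [← e2, mul_div_cancel_left₀ _ hm]
    rw [e1, e3, qPoch_succ, Nat.choose_succ_succ' m 1, Nat.choose_one_right, pow_add,
      show q * z ^ 2 * (q ^ 2) ^ m = z * z * q ^ (2 * m + 1) by ring]
    generalize 1 - z * z * q ^ m = A at *
    generalize 1 - z * z * q ^ (2 * m) = B at *
    generalize 1 - z * z * q ^ (2 * m + 1) = D at *
    field_simp

/-- Induction on k starts at k = m, where all signs are `true`, and appends points of sign `false`.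
The weights of a new point telescope separately over the `true` points, where z cancels, and over
the `false` points, where z² enters. -/
theorem pairProd_signWeight_segment {q z : ℂ} (hq : q ≠ 0) (hq1 : ‖q‖ < 1) (hz : z ≠ 0)
    {m k : ℕ} (hmk : m ≤ k) (hZ : ∀ j ≤ 2 * k, 1 - z * z * q ^ j ≠ 0) :
    pairProd (Finset.range k) (fun i j => signWeight q (decide (i < m)) (z * q ^ i)
        (decide (j < m)) (z * q ^ j)) =
      qPoch (q * z ^ 2) (q ^ 2) k / qPoch (q * z ^ 2) q k *
        ((-1) ^ m * q ^ (k * m)) * ((1 - q ^ (m + m) * z * z) / (1 - z * z)) *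
        (qPoch (q ^ (-(k : ℤ))) q m / qPoch q q m *
          (qPoch (z * z) q m / qPoch (q ^ (1 + k) * z * z) q m)) := by
  have hqq : ∀ k, qPoch q q k ≠ 0 := fun k => qPoch_ne_zero_iff.2 fun j _ => by
    rw [← pow_succ']
    exact one_sub_pow_ne_zero hq1 (Nat.succ_ne_zero j)
  induction k, hmk using Nat.le_induction with
  | base =>
    have h1 : pairProd (Finset.range m) (fun i j => signWeight q (decide (i < m)) (z * q ^ i)
        (decide (j < m)) (z * q ^ j)) = pairProd (Finset.range m)
          (fun i j => signWeight q true (z * q ^ i) true (z * q ^ j)) :=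
      pairProd_congr fun a ha b hb _ => by
        simp [Finset.mem_range.1 ha, Finset.mem_range.1 hb]
    rw [h1, pairProd_signWeight_full m hZ]
    have e1 : qPoch (q ^ (-(m : ℤ))) q m =
        (-1) ^ m * (q ^ (m * m))⁻¹ * q ^ m.choose 2 * qPoch q q m := by
      rw [qPoch_reflect hq (zpow_ne_zero _ hq), zpow_neg, zpow_natCast, inv_inv,
        inv_mul_cancel_right₀ (pow_ne_zero _ hq)]
      congr 1
      have : ∀ j ∈ Finset.range m, -((q ^ m)⁻¹ * q ^ j) = (-1 * (q ^ m)⁻¹) * q ^ j :=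
        fun j _ => by ring
      rw [Finset.prod_congr rfl this, Finset.prod_mul_distrib, Finset.prod_const,
        Finset.prod_pow_eq_pow_sum, Finset.card_range, mul_pow, Finset.sum_range_id,
        Nat.choose_two_right, pow_mul, inv_pow]
    have h0 : 1 - z * z ≠ 0 := by simpa using hZ 0 (by omega)
    have hm := hZ m (by omega)
    have h2m := hZ (2 * m) (by omega)
    have hP : ∀ i ≤ m + 1, qPoch (q ^ i * z ^ 2) q m ≠ 0 := fun i hi =>
      qPoch_ne_zero_iff.2 fun j hj => by
        have := hZ (i + j) (by omega)
        rwa [show q ^ i * z ^ 2 * q ^ j = z * z * q ^ (i + j) by ring]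
    have e2 : qPoch (z * z) q m = (1 - z * z) * qPoch (q * z ^ 2) q m / (1 - z * z * q ^ m) := by
      rw [eq_div_iff hm, ← one_sub_mul_qPoch]
      congr 2
      ring
    have e3 : qPoch (q ^ (1 + m) * z * z) q m =
        qPoch (q ^ m * z ^ 2) q m * (1 - z * z * q ^ (2 * m)) / (1 - z * z * q ^ m) := by
      rw [eq_div_iff hm, mul_comm, show q ^ (1 + m) * z * z = q ^ m * z ^ 2 * q by ring,
        show z * z * q ^ m = q ^ m * z ^ 2 by ring, one_sub_mul_qPoch]
      ring_nf
    have hP1 := hP 1 (by omega)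
    have hPm := hP m (by omega)
    rw [pow_one] at hP1
    have hqm := hqq m
    have hs : ((-1 : ℂ) ^ m) * (-1) ^ m = 1 := by
      rw [← mul_pow]
      simp
    rw [e1, e2, e3, show q ^ (m + m) * z * z = z * z * q ^ (2 * m) by ring]
    have hmm : q ^ (m * m) ≠ 0 := pow_ne_zero _ hq
    generalize qPoch (q * z ^ 2) (q ^ 2) m = A at *
    generalize qPoch (q * z ^ 2) q m = A₁ at *
    generalize q ^ m.choose 2 = B at *
    generalize 1 - z * z * q ^ (2 * m) = D at *
    generalize 1 - z * z * q ^ m = E at *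
    generalize 1 - z * z = F at *
    generalize q ^ (m * m) = H at *
    field_simp
    linear_combination (-(B * A)) * hs
  | succ k hmk ih =>
    rw [pairProd_range_succ fun a b => signWeight_comm _ _ _ _ _, ih fun j hj => hZ j (by omega)]
    obtain ⟨d, rfl⟩ := Nat.exists_eq_add_of_le hmk
    have hqd := one_sub_pow_ne_zero hq1 (Nat.succ_ne_zero d)
    have e1 : ∏ i ∈ Finset.range (m + d), signWeight q (decide (i < m)) (z * q ^ i)
        (decide (m + d < m)) (z * q ^ (m + d)) =
        (1 - q ^ (m + d + 1)) / (1 - q ^ (d + 1)) *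
          ((1 - z * z * q ^ (2 * (m + d) + 1)) / (1 - z * z * q ^ (m + (m + d) + 1))) := by
      rw [Finset.prod_range_add]
      congr 1
      · have h1 : ∀ i ∈ Finset.range m, signWeight q (decide (i < m)) (z * q ^ i)
            (decide (m + d < m)) (z * q ^ (m + d)) =
            (fun i => 1 - (q ^ i)⁻¹ * q ^ (m + d + 1)) i /
              (fun i => 1 - (q ^ i)⁻¹ * q ^ (m + d + 1)) (i + 1) := fun i hi => by
          have hi' := Finset.mem_range.1 hi
          obtain ⟨e, rfl⟩ := Nat.exists_eq_add_of_lt hi'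
          have h3 := one_sub_pow_ne_zero hq1 (Nat.succ_ne_zero (e + d))
          simp only [hi', decide_true, show ¬ (i + e + 1 + d < i + e + 1) by omega, decide_false,
            signWeight, pow_succ q i]
          have h4 : z * q ^ i - z * q ^ (i + e + 1 + d) = z * q ^ i * (1 - q ^ (e + d).succ) := by
            rw [Nat.succ_eq_add_one]
            ring
          have h5 : 1 - (q ^ i * q)⁻¹ * q ^ (i + e + 1 + d + 1) = 1 - q ^ (e + d).succ := by
            rw [Nat.succ_eq_add_one]
            field_simp
            ring
          have h6 : z * q ^ i - q * (z * q ^ (i + e + 1 + d)) =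
              z * q ^ i * (1 - (q ^ i)⁻¹ * q ^ (i + e + 1 + d + 1)) := by
            field_simp
            ring
          rw [h4, h5, h6, mul_div_mul_left _ _ (mul_ne_zero hz (pow_ne_zero _ hq))]
        rw [Finset.prod_congr rfl h1]
        refine (prod_range_div_telescope' (g := fun i => 1 - (q ^ i)⁻¹ * q ^ (m + d + 1))
          ?_ ?_).trans ?_
        · intro j hj
          obtain ⟨e, rfl⟩ := Nat.exists_eq_add_of_lt hj
          have := one_sub_pow_ne_zero hq1 (Nat.succ_ne_zero (e + d))
          rw [show (q ^ (j + 1))⁻¹ * q ^ (j + e + 1 + d + 1) = q ^ (e + d).succ by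
            rw [Nat.succ_eq_add_one]; field_simp; ring]
          exact this
        · rw [show (q ^ m)⁻¹ * q ^ (m + d + 1) = q ^ (d + 1) by field_simp; ring]
          exact hqd
        · rw [show (q ^ m)⁻¹ * q ^ (m + d + 1) = q ^ (d + 1) by field_simp; ring]
          simp
      · have h1 : ∀ i ∈ Finset.range d, signWeight q (decide (m + i < m)) (z * q ^ (m + i))
            (decide (m + d < m)) (z * q ^ (m + d)) =
            (fun i => 1 - z * z * q ^ (m + i + (m + d) + 1)) (i + 1) /
              (fun i => 1 - z * z * q ^ (m + i + (m + d) + 1)) i := fun i _ => by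
          simp only [show ¬ (m + i < m) by omega, decide_false,
            show ¬ (m + d < m) by omega, signWeight]
          ring_nf
        rw [Finset.prod_congr rfl h1]
        refine (prod_range_div_telescope (g := fun i => 1 - z * z * q ^ (m + i + (m + d) + 1))
          ?_ ?_).trans ?_
        · exact fun j hj => hZ _ (by omega)
        · exact hZ _ (by omega)
        · ring_nf
    have h0 : 1 - z * z ≠ 0 := by simpa using hZ 0 (by omega)
    have hk1 := hZ (m + d + 1) (by omega)
    have hmk1 := hZ (m + (m + d) + 1) (by omega)
    have hZP : qPoch (q ^ (1 + (m + d)) * z * z) q m ≠ 0 := qPoch_ne_zero_iff.2 fun j hj => by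
      have := hZ (1 + (m + d) + j) (by omega)
      rwa [show q ^ (1 + (m + d)) * z * z * q ^ j = z * z * q ^ (1 + (m + d) + j) by ring]
    have e2 : qPoch (q ^ (1 + (m + d + 1)) * z * z) q m =
        qPoch (q ^ (1 + (m + d)) * z * z) q m * (1 - z * z * q ^ (m + (m + d) + 1)) /
          (1 - z * z * q ^ (m + d + 1)) := by
      rw [eq_div_iff hk1, mul_comm,
        show q ^ (1 + (m + d + 1)) * z * z = q ^ (1 + (m + d)) * z * z * q by ring,
        show z * z * q ^ (m + d + 1) = q ^ (1 + (m + d)) * z * z by ring, one_sub_mul_qPoch]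
      ring_nf
    have e3 : q ^ m * qPoch (q ^ (-((m + d + 1 : ℕ) : ℤ))) q m =
        (1 - q ^ (m + d + 1)) / (1 - q ^ (d + 1)) * qPoch (q ^ (-((m + d : ℕ) : ℤ))) q m := by
      have h := one_sub_mul_qPoch (q ^ (-((m + d + 1 : ℕ) : ℤ))) q m
      rw [← zpow_add_one₀ hq,
        show -((m + d + 1 : ℕ) : ℤ) + 1 = -((m + d : ℕ) : ℤ) by push_cast; ring] at h
      have h2 : 1 - q ^ (-((m + d + 1 : ℕ) : ℤ)) = -(1 - q ^ (m + d + 1)) / q ^ (m + d + 1) := by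
        rw [zpow_neg, zpow_natCast]
        field_simp
        ring
      have h3 : 1 - q ^ (-((m + d + 1 : ℕ) : ℤ)) * q ^ m = -(1 - q ^ (d + 1)) / q ^ (d + 1) := by
        rw [zpow_neg, zpow_natCast]
        field_simp
        ring
      rw [h2, h3] at h
      rw [Nat.succ_eq_add_one] at hqd
      generalize qPoch (q ^ (-((m + d + 1 : ℕ) : ℤ))) q m = A at *
      generalize qPoch (q ^ (-((m + d : ℕ) : ℤ))) q m = B at *
      have hx : q ^ (m + d + 1) = q ^ m * q ^ (d + 1) := by ring
      rw [div_mul_eq_mul_div, eq_div_iff hqd]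
      rw [div_mul_eq_mul_div, mul_div_assoc', div_eq_div_iff (pow_ne_zero _ hq) (pow_ne_zero _ hq)]
        at h
      apply mul_right_cancel₀ (pow_ne_zero (d + 1) hq)
      rw [hx] at h ⊢
      linear_combination h
    have hK : qPoch (q * z ^ 2) q (m + d) ≠ 0 := qPoch_ne_zero_iff.2 fun j hj => by
      have := hZ (1 + j) (by omega)
      rwa [show q * z ^ 2 * q ^ j = z * z * q ^ (1 + j) by ring]
    rw [e1, e2, qPoch_succ _ _ (m + d), qPoch_succ _ _ (m + d),
      show q * z ^ 2 * (q ^ 2) ^ (m + d) = z * z * q ^ (2 * (m + d) + 1) by ring,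
      show q * z ^ 2 * q ^ (m + d) = z * z * q ^ (m + d + 1) by ring,
      show q ^ ((m + d + 1) * m) = q ^ ((m + d) * m) * q ^ m by ring]
    have hqm := hqq m
    rw [Nat.succ_eq_add_one] at hqd
    generalize qPoch (q ^ (-((m + d + 1 : ℕ) : ℤ))) q m = A at *
    generalize qPoch (q ^ (-((m + d : ℕ) : ℤ))) q m = B at *
    generalize qPoch (q ^ (1 + (m + d)) * z * z) q m = D at *
    generalize qPoch (q * z ^ 2) q (m + d) = E at *
    generalize qPoch (q * z ^ 2) (q ^ 2) (m + d) = F at *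
    generalize 1 - z * z * q ^ (2 * (m + d) + 1) = H at *
    generalize 1 - z * z * q ^ (m + (m + d) + 1) = J at *
    generalize 1 - z * z * q ^ (m + d + 1) = N at *
    generalize 1 - q ^ (m + m) * z * z = M at *
    generalize 1 - q ^ (m + d + 1) = U at *
    generalize 1 - q ^ (d + 1) = V at *
    generalize q ^ ((m + d) * m) = W at *
    calc _ = F * H / E * ((-1) ^ m * W) * (M / (1 - z * z)) *
          (U / V * B / qPoch q q m * (qPoch (z * z) q m / (D * J))) := by
          field_simp
      _ = _ := by
          rw [← e3]
          field_simp

end SelfBlock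

/-! ### Pair weights between two geometric progressions. -/

section CrossBlock

theorem prod_signWeight_true_true {q u v : ℂ} {m l : ℕ}
    (hZ : ∀ j ≤ m + l, 1 - u * v * q ^ j ≠ 0) :
    ∏ i ∈ Finset.range m, ∏ j ∈ Finset.range l,
        signWeight q true (u * q ^ i) true (v * q ^ j) =
      q ^ (l * m) * qPoch (u * v) q m / qPoch (q ^ l * u * v) q m := by
  have h1 : ∀ i ∈ Finset.range m, ∏ j ∈ Finset.range l,
      signWeight q true (u * q ^ i) true (v * q ^ j) =
      q ^ l * ((1 - u * v * q ^ i) / (1 - q ^ l * u * v * q ^ i)) := by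
    intro i hi
    have hi' := Finset.mem_range.1 hi
    have h2 : ∀ j ∈ Finset.range l, signWeight q true (u * q ^ i) true (v * q ^ j) =
        q * ((fun j => 1 - u * v * q ^ (i + j)) j / (fun j => 1 - u * v * q ^ (i + j)) (j + 1)) :=
      fun j _ => by
        simp only [signWeight]
        ring_nf
    rw [Finset.prod_congr rfl h2, Finset.prod_mul_distrib, prod_range_div_telescope'
      (g := fun j => 1 - u * v * q ^ (i + j)) (fun j hj => hZ _ (by omega)) (hZ _ (by omega)),
      Finset.prod_const, Finset.card_range]
    ring_nf
  rw [Finset.prod_congr rfl h1, Finset.prod_mul_distrib, Finset.prod_div_distrib,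
    Finset.prod_const, Finset.card_range, ← pow_mul, mul_div_assoc]
  rfl

theorem prod_signWeight_true_false {q u v : ℂ} (hq : q ≠ 0) (hv : v ≠ 0) {m l d : ℕ}
    (hx : ∀ i ≤ m, ∀ j ≤ l + d, i < m → u * q ^ i - v * q ^ j ≠ 0) :
    ∏ i ∈ Finset.range m, ∏ j ∈ Finset.range d,
        signWeight q true (u * q ^ i) false (v * q ^ (l + j)) =
      q ^ (d * m) * qPoch ((q ^ (l + d))⁻¹ * (u / v)) q m / qPoch ((q ^ l)⁻¹ * (u / v)) q m := by
  have h1 : ∀ i ∈ Finset.range m, ∏ j ∈ Finset.range d,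
      signWeight q true (u * q ^ i) false (v * q ^ (l + j)) =
      q ^ d * ((1 - (q ^ (l + d))⁻¹ * (u / v) * q ^ i) / (1 - (q ^ l)⁻¹ * (u / v) * q ^ i)) := by
    intro i hi
    have hi' := Finset.mem_range.1 hi
    have h2 : ∀ j ∈ Finset.range d, signWeight q true (u * q ^ i) false (v * q ^ (l + j)) =
        (fun j => u * q ^ i - v * q ^ (l + j)) (j + 1) / (fun j => u * q ^ i - v * q ^ (l + j)) j :=
      fun j _ => by
        simp only [signWeight]
        ring_nf
    rw [Finset.prod_congr rfl h2, prod_range_div_telescope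
      (g := fun j => u * q ^ i - v * q ^ (l + j))
      (fun j hj => hx i hi'.le _ (by omega) hi') (hx i hi'.le _ (by omega) hi')]
    have e : ∀ N : ℕ, u * q ^ i - v * q ^ N = -(v * q ^ N) * (1 - (q ^ N)⁻¹ * (u / v) * q ^ i) := by
      intro N
      field_simp
      ring
    rw [e, e, mul_div_mul_comm]
    congr 1
    simp only [pow_add, add_zero]
    field_simp
  rw [Finset.prod_congr rfl h1, Finset.prod_mul_distrib, Finset.prod_div_distrib,
    Finset.prod_const, Finset.card_range, ← pow_mul, mul_div_assoc]
  rfl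

theorem prod_signWeight_false_false {q u v : ℂ} {m d l e : ℕ}
    (hZ : ∀ j ≤ m + d + (l + e), 1 - u * v * q ^ j ≠ 0) :
    ∏ i ∈ Finset.range d, ∏ j ∈ Finset.range e,
        signWeight q false (u * q ^ (m + i)) false (v * q ^ (l + j)) =
      qPoch (q ^ (m + (l + e) + 1) * u * v) q d / qPoch (q ^ (m + l + 1) * u * v) q d := by
  have h1 : ∀ i ∈ Finset.range d, ∏ j ∈ Finset.range e,
      signWeight q false (u * q ^ (m + i)) false (v * q ^ (l + j)) =
      (1 - q ^ (m + (l + e) + 1) * u * v * q ^ i) / (1 - q ^ (m + l + 1) * u * v * q ^ i) := by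
    intro i hi
    have hi' := Finset.mem_range.1 hi
    have h2 : ∀ j ∈ Finset.range e, signWeight q false (u * q ^ (m + i)) false (v * q ^ (l + j)) =
        (fun j => 1 - u * v * q ^ (m + i + l + j + 1)) (j + 1) /
          (fun j => 1 - u * v * q ^ (m + i + l + j + 1)) j :=
      fun j _ => by
        simp only [signWeight]
        ring_nf
    rw [Finset.prod_congr rfl h2, prod_range_div_telescope
      (g := fun j => 1 - u * v * q ^ (m + i + l + j + 1)) (fun j hj => hZ _ (by omega))
      (hZ _ (by omega))]
    ring_nf
  rw [Finset.prod_congr rfl h1, Finset.prod_div_distrib]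
  rfl

/-- The rectangle splits into four blocks of constant signs, each telescoping in one direction. The
factors in uv and those in u/v are then matched independently, the latter by `qPoch_cross`. -/
theorem prod_signWeight_rect {q u v : ℂ} (hq : q ≠ 0) (hu : u ≠ 0) (hv : v ≠ 0)
    {m M l N : ℕ} (hm : m ≤ M) (hl : l ≤ N) (hZ : ∀ j ≤ M + N, 1 - u * v * q ^ j ≠ 0)
    (hx : ∀ i ≤ M, ∀ j ≤ N, u * q ^ i - v * q ^ j ≠ 0) :
    ∏ i ∈ Finset.range M, ∏ j ∈ Finset.range N,
        signWeight q (decide (i < m)) (u * q ^ i) (decide (j < l)) (v * q ^ j) =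
      qPoch (q ^ (N + 1) * u * v) q M / qPoch (q * u * v) q M * q ^ (N * m + M * l) *
        ((q ^ m * u - q ^ l * v) / (u - v)) * ((1 - q ^ (m + l) * u * v) / (1 - u * v)) *
        (qPoch (q ^ (-(N : ℤ)) * u / v) q m / qPoch (q * u / v) q m *
          (qPoch (u * v) q m / qPoch (q ^ (1 + N) * u * v) q m)) *
        (qPoch (q ^ (-(M : ℤ)) * v / u) q l / qPoch (q * v / u) q l *
          (qPoch (v * u) q l / qPoch (q ^ (1 + M) * v * u) q l)) := by
  obtain ⟨d, rfl⟩ := Nat.exists_eq_add_of_le hm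
  obtain ⟨e, rfl⟩ := Nat.exists_eq_add_of_le hl
  have tt : ∏ i ∈ Finset.range m, ∏ j ∈ Finset.range l,
      signWeight q (decide (i < m)) (u * q ^ i) (decide (j < l)) (v * q ^ j) =
      q ^ (l * m) * qPoch (u * v) q m / qPoch (q ^ l * u * v) q m := by
    rw [← prod_signWeight_true_true fun j hj => hZ j (by omega)]
    refine Finset.prod_congr rfl fun i hi => Finset.prod_congr rfl fun j hj => ?_
    rw [decide_eq_true (Finset.mem_range.1 hi), decide_eq_true (Finset.mem_range.1 hj)]
  have tf : ∏ i ∈ Finset.range m, ∏ j ∈ Finset.range e,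
      signWeight q (decide (i < m)) (u * q ^ i) (decide (l + j < l)) (v * q ^ (l + j)) =
      q ^ (e * m) * qPoch ((q ^ (l + e))⁻¹ * (u / v)) q m / qPoch ((q ^ l)⁻¹ * (u / v)) q m := by
    rw [← prod_signWeight_true_false hq hv fun i _ j hj _ => hx i (by omega) j hj]
    refine Finset.prod_congr rfl fun i hi => Finset.prod_congr rfl fun j hj => ?_
    rw [decide_eq_true (Finset.mem_range.1 hi), decide_eq_false (by omega : ¬ l + j < l)]
  have ft : ∏ i ∈ Finset.range d, ∏ j ∈ Finset.range l,
      signWeight q (decide (m + i < m)) (u * q ^ (m + i)) (decide (j < l)) (v * q ^ j) =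
      q ^ (d * l) * qPoch ((q ^ (m + d))⁻¹ * (v / u)) q l / qPoch ((q ^ m)⁻¹ * (v / u)) q l := by
    rw [Finset.prod_comm, ← prod_signWeight_true_false hq hu fun j _ i hi _ => by
      rw [← neg_sub]
      exact neg_ne_zero.2 (hx i hi j (by omega))]
    refine Finset.prod_congr rfl fun j hj => Finset.prod_congr rfl fun i hi => ?_
    rw [decide_eq_true (Finset.mem_range.1 hj), decide_eq_false (by omega : ¬ m + i < m),
      signWeight_comm]
  have ff : ∏ i ∈ Finset.range d, ∏ j ∈ Finset.range e,
      signWeight q (decide (m + i < m)) (u * q ^ (m + i)) (decide (l + j < l)) (v * q ^ (l + j)) =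
      qPoch (q ^ (m + (l + e) + 1) * u * v) q d / qPoch (q ^ (m + l + 1) * u * v) q d := by
    rw [← prod_signWeight_false_false hZ]
    refine Finset.prod_congr rfl fun i hi => Finset.prod_congr rfl fun j hj => ?_
    rw [decide_eq_false (by omega : ¬ m + i < m), decide_eq_false (by omega : ¬ l + j < l)]
  simp only [Finset.prod_range_add, Finset.prod_mul_distrib, tt, tf, ft, ff]
  have hPZ : ∀ i j, i + j ≤ m + d + (l + e) + 1 → qPoch (q ^ i * u * v) q j ≠ 0 := fun i j hij =>
    qPoch_ne_zero_iff.2 fun t ht => by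
      have := hZ (i + t) (by omega)
      rwa [show q ^ i * u * v * q ^ t = u * v * q ^ (i + t) by ring]
  have huv : u - v ≠ 0 := by simpa using hx 0 (by omega) 0 (by omega)
  have h0 : 1 - u * v ≠ 0 := by simpa using hZ 0 (by omega)
  have hml := hZ (m + l) (by omega)
  -- the factors depending on the product of the two variables
  have z1 : qPoch (q ^ (l + e + 1) * u * v) q (m + d) =
      qPoch (q ^ (1 + (l + e)) * u * v) q m * qPoch (q ^ (m + (l + e) + 1) * u * v) q d := by
    rw [qPoch_add]
    congr 2 <;> ring
  have z2 : qPoch (u * v) q l * (qPoch (q ^ l * u * v) q m * ((1 - q ^ (m + l) * u * v) *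
      qPoch (q ^ (m + l + 1) * u * v) q d)) = (1 - u * v) * (qPoch (q * u * v) q (m + d) *
        qPoch (q ^ (1 + (m + d)) * v * u) q l) := by
    have h1 := qPoch_succ' (u * v) q (m + d + l)
    rw [qPoch_add _ _ (m + d) l, show m + d + l + 1 = l + (m + (d + 1)) by ring, qPoch_add,
      qPoch_add _ _ m, qPoch_succ'] at h1
    rw [show q ^ l * u * v = u * v * q ^ l by ring,
      show q ^ (m + l) * u * v = u * v * q ^ l * q ^ m by ring,
      show q ^ (m + l + 1) * u * v = u * v * q ^ l * q ^ m * q by ring,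
      show q * u * v = u * v * q by ring,
      show q ^ (1 + (m + d)) * v * u = u * v * q * q ^ (m + d) by ring, h1]
  -- the factors depending on the quotient of the two variables
  have x1 := qPoch_cross hq (div_ne_zero hu hv) m l
  rw [inv_div] at x1
  have x2 : ∀ i ≤ m + d, ∀ j ≤ l + e, 1 - q ^ i * (q ^ j)⁻¹ * (u / v) ≠ 0 := fun i hi j hj h => by
    apply hx i hi j hj
    have : u * q ^ i - v * q ^ j = -(v * q ^ j) * (1 - q ^ i * (q ^ j)⁻¹ * (u / v)) := by
      field_simp
      ring
    rw [this, h, mul_zero]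
  have x3 : ∀ i ≤ m + d, ∀ j ≤ l + e, 1 - q ^ j * (q ^ i)⁻¹ * (v / u) ≠ 0 := fun i hi j hj h => by
    apply hx i hi j hj
    have : u * q ^ i - v * q ^ j = (u * q ^ i) * (1 - q ^ j * (q ^ i)⁻¹ * (v / u)) := by
      field_simp
    rw [this, h, mul_zero]
  have p1 : qPoch ((q ^ l)⁻¹ * (u / v)) q m ≠ 0 := qPoch_ne_zero_iff.2 fun t ht => by
    have := x2 t (by omega) l (by omega)
    rwa [show (q ^ l)⁻¹ * (u / v) * q ^ t = q ^ t * (q ^ l)⁻¹ * (u / v) by ring]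
  have p2 : qPoch ((q ^ m)⁻¹ * (v / u)) q l ≠ 0 := qPoch_ne_zero_iff.2 fun t ht => by
    have := x3 m (by omega) t (by omega)
    rwa [show (q ^ m)⁻¹ * (v / u) * q ^ t = q ^ t * (q ^ m)⁻¹ * (v / u) by ring]
  have p3 : qPoch (q * (u / v)) q m ≠ 0 := qPoch_ne_zero_iff.2 fun t ht => by
    have := x2 (t + 1) (by omega) 0 (by omega)
    rwa [show q * (u / v) * q ^ t = q ^ (t + 1) * (q ^ 0)⁻¹ * (u / v) by simp; ring]
  have p4 : qPoch (q * (v / u)) q l ≠ 0 := qPoch_ne_zero_iff.2 fun t ht => by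
    have := x3 0 (by omega) (t + 1) (by omega)
    rwa [show q * (v / u) * q ^ t = q ^ (t + 1) * (q ^ 0)⁻¹ * (v / u) by simp; ring]
  have a1 := hPZ l m (by omega)
  have a2 := hPZ (m + l + 1) d (by omega)
  have a3 := hPZ (1 + (l + e)) m (by omega)
  have a4 : qPoch (q * u * v) q (m + d) ≠ 0 := by simpa using hPZ 1 (m + d) (by omega)
  have a5 : qPoch (q ^ (1 + (m + d)) * v * u) q l ≠ 0 := by
    rw [mul_right_comm]
    exact hPZ (1 + (m + d)) l (by omega)
  have x4 : (q ^ m * u - q ^ l * v) / (u - v) * (q ^ (m * l) *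
      (qPoch ((q ^ l)⁻¹ * (u / v)) q m * qPoch ((q ^ m)⁻¹ * (v / u)) q l)) =
      qPoch (q * (u / v)) q m * qPoch (q * (v / u)) q l := by
    rw [div_mul_eq_mul_div, div_eq_iff huv]
    have h1 : q ^ m * u - q ^ l * v = v * (q ^ m * (u / v) - q ^ l) := by field_simp
    have h2 : u - v = v * (u / v - 1) := by field_simp
    rw [h1, h2]
    linear_combination (-v) * x1
  have x5 : (q ^ m * u - q ^ l * v) / (u - v) = qPoch (q * (u / v)) q m * qPoch (q * (v / u)) q l /
      (q ^ (m * l) *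
      (qPoch ((q ^ l)⁻¹ * (u / v)) q m * qPoch ((q ^ m)⁻¹ * (v / u)) q l)) := by
    rw [eq_div_iff (mul_ne_zero (pow_ne_zero _ hq) (mul_ne_zero p1 p2)), x4]
  have z3 : (1 - q ^ (m + l) * u * v) / (1 - u * v) * qPoch (u * v) q l =
      qPoch (q * u * v) q (m + d) * qPoch (q ^ (1 + (m + d)) * v * u) q l /
        (qPoch (q ^ l * u * v) q m * qPoch (q ^ (m + l + 1) * u * v) q d) := by
    rw [eq_div_iff (mul_ne_zero a1 a2), div_mul_eq_mul_div, div_mul_eq_mul_div, div_eq_iff h0]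
    linear_combination z2
  rw [show (q ^ (-((l + e : ℕ) : ℤ)) * u / v) = (q ^ (l + e))⁻¹ * (u / v) by
      rw [zpow_neg, zpow_natCast]; ring,
    show (q ^ (-((m + d : ℕ) : ℤ)) * v / u) = (q ^ (m + d))⁻¹ * (v / u) by
      rw [zpow_neg, zpow_natCast]; ring, mul_div_assoc q u v, mul_div_assoc q v u, mul_comm v u,
    z1, x5]
  generalize qPoch ((q ^ (l + e))⁻¹ * (u / v)) q m = X1 at *
  generalize qPoch ((q ^ (m + d))⁻¹ * (v / u)) q l = X2 at *
  generalize qPoch ((q ^ l)⁻¹ * (u / v)) q m = X3 at *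
  generalize qPoch ((q ^ m)⁻¹ * (v / u)) q l = X4 at *
  generalize qPoch (q * (u / v)) q m = X5 at *
  generalize qPoch (q * (v / u)) q l = X6 at *
  generalize qPoch (q ^ (1 + (l + e)) * u * v) q m = Z1 at *
  generalize qPoch (q ^ (m + (l + e) + 1) * u * v) q d = Z2 at *
  generalize qPoch (q ^ (m + l + 1) * u * v) q d = Z3 at *
  generalize qPoch (q * u * v) q (m + d) = Z4 at *
  generalize qPoch (q ^ (1 + (m + d)) * v * u) q l = Z5 at *
  generalize qPoch (q ^ l * u * v) q m = Z6 at *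
  generalize qPoch (u * v) q l = Z7 at *
  generalize qPoch (u * v) q m = Z8 at *
  calc _ = q ^ (l * m) * q ^ (e * m) * q ^ (d * l) * Z8 * X1 * X2 * Z2 / (Z6 * Z3 * X3 * X4) := by
        field_simp
    _ = Z1 * Z2 / Z4 * q ^ ((l + e) * m + (m + d) * l) * (X5 * X6 / (q ^ (m * l) * (X3 * X4))) *
        (X1 / X5 * (Z8 / Z1)) * (X2 / X6 / Z5) * (Z4 * Z5 / (Z6 * Z3)) := by
        rw [show q ^ ((l + e) * m + (m + d) * l) = q ^ (l * m) * q ^ (e * m) * q ^ (d * l) *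
          q ^ (m * l) by ring]
        field_simp
    _ = _ := by
        rw [← z3]
        ring

end CrossBlock

/-! ### Multiple principal specialization: reduction to initial segments. -/

section Segments

variable {s : ℕ}

/-- The index set of the pairs `(l, j)` with `j < m l`, ordered lexicographically. -/
def segmentSet (m : Fin s → ℕ) : Finset (Fin s ×ₗ ℕ) :=
  (Finset.univ.sigma fun l => Finset.range (m l)).map
    ⟨fun p => toLex (p.1, p.2), fun p p' h => by
      have := toLex.injective h
      rcases p with ⟨a, i⟩
      rcases p' with ⟨b, j⟩
      simp only [Prod.mk.injEq] at this
      obtain ⟨rfl, rfl⟩ := this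
      rfl⟩

theorem mem_segmentSet {m : Fin s → ℕ} {l : Fin s} {j : ℕ} :
    toLex (l, j) ∈ segmentSet m ↔ j < m l := by
  simp only [segmentSet, Finset.mem_map, Finset.mem_sigma, Finset.mem_univ, true_and,
    Finset.mem_range]
  constructor
  · rintro ⟨⟨a, i⟩, h, e⟩
    have := toLex.injective e
    simp only [Prod.mk.injEq] at this
    obtain ⟨rfl, rfl⟩ := this
    exact h
  · exact fun h => ⟨⟨l, j⟩, h, rfl⟩

theorem prod_segmentSet (m : Fin s → ℕ) (F : Fin s ×ₗ ℕ → ℂ) :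
    ∏ p ∈ segmentSet m, F p = ∏ l, ∏ j ∈ Finset.range (m l), F (toLex (l, j)) := by
  rw [segmentSet, Finset.prod_map, Finset.prod_sigma]
  rfl

theorem card_segmentSet (m : Fin s → ℕ) : (segmentSet m).card = ∑ l, m l := by
  simp [segmentSet]

/-- In the lexicographic order the progressions are consecutive, so the pairs lie either inside one
progression or in a full rectangle indexed by a < b. -/
theorem pairProd_segmentSet (k : Fin s → ℕ) (g : Fin s ×ₗ ℕ → Fin s ×ₗ ℕ → ℂ) :
    pairProd (segmentSet k) g =
      (∏ a, pairProd (Finset.range (k a)) fun i j => g (toLex (a, i)) (toLex (a, j))) *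
      ∏ a, ∏ b ∈ Finset.Ioi a, ∏ i ∈ Finset.range (k a), ∏ j ∈ Finset.range (k b),
        g (toLex (a, i)) (toLex (b, j)) := by
  unfold pairProd
  simp only [prod_segmentSet]
  rw [← Finset.prod_mul_distrib]
  refine Finset.prod_congr rfl fun a _ => ?_
  rw [Finset.prod_comm, ← Finset.prod_subset (Finset.subset_univ (Finset.Ici a)),
    ← Finset.Ioi_insert, Finset.prod_insert Finset.notMem_Ioi_self]
  · congr 1
    · refine Finset.prod_congr rfl fun i _ => Finset.prod_congr rfl fun j _ => ?_
      simp [Prod.Lex.toLex_lt_toLex]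
    · refine Finset.prod_congr rfl fun b hb => Finset.prod_congr rfl fun i _ =>
        Finset.prod_congr rfl fun j _ => ?_
      simp [Prod.Lex.toLex_lt_toLex, Finset.mem_Ioi.1 hb]
  · intro b _ hb
    have hb' : b < a := by simpa using hb
    refine Finset.prod_eq_one fun i _ => Finset.prod_eq_one fun j _ => ?_
    simp [Prod.Lex.toLex_lt_toLex, hb'.not_gt, hb'.ne']

theorem segmentSet_injective : Function.Injective (segmentSet (s := s)) := by
  intro m m' h
  funext l
  have h1 : ∀ j, j < m l ↔ j < m' l := fun j => by
    rw [← mem_segmentSet, ← mem_segmentSet, h]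
  exact le_antisymm (le_of_not_gt fun h2 => (lt_irrefl _ ((h1 _).1 h2)))
    (le_of_not_gt fun h2 => (lt_irrefl _ ((h1 _).2 h2)))

theorem exists_eq_segmentSet {k : Fin s → ℕ} {S : Finset (Fin s ×ₗ ℕ)} (hS : S ⊆ segmentSet k)
    (hd : ∀ l j, toLex (l, j + 1) ∈ S → toLex (l, j) ∈ S) : ∃ m ≤ k, segmentSet m = S := by
  classical
  have hk : ∀ l, ∃ j, toLex (l, j) ∉ S := fun l =>
    ⟨k l, fun h => lt_irrefl _ (mem_segmentSet.1 (hS h))⟩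
  -- The length of the l-th segment is the least j missing from `S`.
  refine ⟨fun l => Nat.find (hk l), fun l => Nat.find_min' (hk l)
    fun h => lt_irrefl _ (mem_segmentSet.1 (hS h)), ?_⟩
  have hup : ∀ l j, Nat.find (hk l) ≤ j → toLex (l, j) ∉ S := by
    intro l j hj
    induction j, hj using Nat.le_induction with
    | base => exact Nat.find_spec (hk l)
    | succ j _ ih => exact fun h => ih (hd l j h)
  ext p
  obtain ⟨⟨l, j⟩, rfl⟩ := toLex.surjective p
  rw [mem_segmentSet]
  constructor
  · intro h
    by_contra hn
    exact Nat.find_min (hk l) h hn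
  · intro h
    by_contra hn
    exact hup l j (not_lt.1 hn) h

/-- The multiple principal specialization of the variables. -/
noncomputable def segmentVar (q : ℂ) (z : Fin s → ℂ) (p : Fin s ×ₗ ℕ) : ℂ :=
  z (ofLex p).1 * q ^ (ofLex p).2

/-- Under multiple principal specialization only unions of initial segments contribute. -/
theorem signSum_segmentSet (q : ℂ) (z : Fin s → ℂ) (k : Fin s → ℕ)
    (f : Bool → Fin s ×ₗ ℕ → ℂ) :
    signSum q (segmentVar q z) (segmentSet k) f = ∑ m ∈ Finset.Iic k,
      (∏ l, ∏ j ∈ Finset.range (k l), f (decide (j < m l)) (toLex (l, j))) *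
        ((∏ a, pairProd (Finset.range (k a)) fun i j => signWeight q (decide (i < m a))
          (z a * q ^ i) (decide (j < m a)) (z a * q ^ j)) *
        ∏ a, ∏ b ∈ Finset.Ioi a, ∏ i ∈ Finset.range (k a), ∏ j ∈ Finset.range (k b),
          signWeight q (decide (i < m a)) (z a * q ^ i) (decide (j < m b)) (z b * q ^ j)) := by
  unfold signSum
  have hsub : (Finset.Iic k).image segmentSet ⊆ (segmentSet k).powerset := by
    intro S hS
    obtain ⟨m, hm, rfl⟩ := Finset.mem_image.1 hS
    rw [Finset.mem_powerset]
    intro p hp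
    obtain ⟨⟨l, j⟩, rfl⟩ := toLex.surjective p
    exact mem_segmentSet.2 ((mem_segmentSet.1 hp).trans_le (Finset.mem_Iic.1 hm l))
  rw [← Finset.sum_subset hsub, Finset.sum_image fun a _ b _ h => segmentSet_injective h]
  · refine Finset.sum_congr rfl fun m _ => ?_
    rw [prod_segmentSet, pairProd_segmentSet]
    simp only [mem_segmentSet, segmentVar, ofLex_toLex]
  · intro S hS hS'
    rw [Finset.mem_powerset] at hS
    have : ∃ l j, toLex (l, j + 1) ∈ S ∧ toLex (l, j) ∉ S := by
      by_contra hn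
      push Not at hn
      obtain ⟨m, hm, e⟩ := exists_eq_segmentSet hS hn
      exact hS' (Finset.mem_image.2 ⟨m, Finset.mem_Iic.2 hm, e⟩)
    obtain ⟨l, j, h1, h2⟩ := this
    have h3 : j + 1 < k l := mem_segmentSet.1 (hS h1)
    -- The pair x, qx with signs `false`, `true` has weight with numerator qx - qx = 0.
    refine mul_eq_zero_of_right _ (Finset.prod_eq_zero (i := toLex (l, j))
      (mem_segmentSet.2 (by omega)) (Finset.prod_eq_zero (i := toLex (l, j + 1)) (hS h1) ?_))
    have h4 : toLex (l, j) < toLex (l, j + 1) := by simp [Prod.Lex.toLex_lt_toLex]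
    simp only [h4, if_true, h1, h2, decide_true, decide_false, signWeight, segmentVar, ofLex_toLex]
    rw [pow_succ]
    simp only [div_eq_zero_iff]
    left
    ring

theorem prod_prod_eq_diag_mul_Ioi (F : Fin s → Fin s → ℂ) :
    ∏ a, ∏ b, F a b = (∏ a, F a a) * ∏ a, ∏ b ∈ Finset.Ioi a, F a b * F b a := by
  have h := Finset.prod_prod_Ioi_mul_eq_prod_prod_off_diag fun b a => F a b
  rw [h, ← Finset.prod_mul_distrib]
  refine Finset.prod_congr rfl fun a _ => ?_
  rw [← Finset.mul_prod_erase _ _ (Finset.mem_univ a)]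
  congr 1
  exact Finset.prod_congr (by ext; simp) fun _ _ => rfl

theorem prod_Ici_eq (F : Fin s → Fin s → ℂ) :
    ∏ a, ∏ b ∈ Finset.Ici a, F a b = (∏ a, F a a) * ∏ a, ∏ b ∈ Finset.Ioi a, F a b := by
  rw [← Finset.prod_mul_distrib]
  refine Finset.prod_congr rfl fun a _ => ?_
  rw [← Finset.Ioi_insert, Finset.prod_insert Finset.notMem_Ioi_self]

/-- The product of all pair weights of a union of initial segments. -/
theorem prod_signWeight_segments {q : ℂ} (hq : q ≠ 0) (hq1 : ‖q‖ < 1) {z : Fin s → ℂ}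
    (hz : ∀ l, z l ≠ 0) {k m : Fin s → ℕ} (hm : m ≤ k)
    (hZ : ∀ a b, ∀ j ≤ k a + k b, 1 - z a * z b * q ^ j ≠ 0)
    (hx : ∀ a b, a ≠ b → ∀ i ≤ k a, ∀ j ≤ k b, z a * q ^ i - z b * q ^ j ≠ 0) :
    (∏ a, pairProd (Finset.range (k a)) fun i j => signWeight q (decide (i < m a))
          (z a * q ^ i) (decide (j < m a)) (z a * q ^ j)) *
        ∏ a, ∏ b ∈ Finset.Ioi a, ∏ i ∈ Finset.range (k a), ∏ j ∈ Finset.range (k b),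
          signWeight q (decide (i < m a)) (z a * q ^ i) (decide (j < m b)) (z b * q ^ j) =
      (∏ a, ∏ b ∈ Finset.Ioi a,
        qPoch (q ^ (k b + 1) * z a * z b) q (k a) / qPoch (q * z a * z b) q (k a)) *
      (∏ a, qPoch (q * z a ^ 2) (q ^ 2) (k a) / qPoch (q * z a ^ 2) q (k a)) *
      ((-1) ^ (∑ l, m l) * q ^ ((∑ l, k l) * ∑ l, m l)) * cCoeff k q z m := by
  have hself : ∀ a, pairProd (Finset.range (k a)) (fun i j => signWeight q (decide (i < m a))
          (z a * q ^ i) (decide (j < m a)) (z a * q ^ j)) =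
      qPoch (q * z a ^ 2) (q ^ 2) (k a) / qPoch (q * z a ^ 2) q (k a) *
        ((-1) ^ m a * q ^ (k a * m a)) * ((1 - q ^ (m a + m a) * z a * z a) / (1 - z a * z a)) *
        (qPoch (q ^ (-(k a : ℤ)) * z a / z a) q (m a) / qPoch (q * z a / z a) q (m a) *
          (qPoch (z a * z a) q (m a) / qPoch (q ^ (1 + k a) * z a * z a) q (m a))) := by
    intro a
    -- The quotients by z_a were kept so that the self block has the shape of the diagonal factors
    -- of `cCoeff`.
    rw [mul_div_cancel_right₀ _ (hz a), mul_div_cancel_right₀ _ (hz a)]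
    exact pairProd_signWeight_segment hq hq1 (hz a) (hm a) fun j hj => hZ a a j (by omega)
  have hrect : ∀ a, ∀ b ∈ Finset.Ioi a, ∏ i ∈ Finset.range (k a), ∏ j ∈ Finset.range (k b),
      signWeight q (decide (i < m a)) (z a * q ^ i) (decide (j < m b)) (z b * q ^ j) = _ :=
    fun a b hb => prod_signWeight_rect hq (hz a) (hz b) (hm a) (hm b) (hZ a b)
      (hx a b (Finset.mem_Ioi.1 hb).ne)
  -- The exponents k_a m_a of the self blocks and k_b m_a + k_a m_b of the cross blocks add up to
  -- |k||m|.
  have hpow : q ^ ((∑ l, k l) * ∑ l, m l) = (∏ a, q ^ (k a * m a)) *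
      ∏ a, ∏ b ∈ Finset.Ioi a, q ^ (k b * m a + k a * m b) := by
    have h := prod_prod_eq_diag_mul_Ioi fun a b => q ^ (k b * m a)
    simp only [← pow_add] at h
    rw [← h, Finset.sum_mul_sum, ← Finset.prod_pow_eq_pow_sum, Finset.prod_comm]
    refine Finset.prod_congr rfl fun a _ => ?_
    rw [Finset.prod_pow_eq_pow_sum]
  rw [Finset.prod_congr rfl fun a _ => hself a,
    Finset.prod_congr rfl fun a _ => Finset.prod_congr rfl (hrect a), hpow, cCoeff,
    prod_prod_eq_diag_mul_Ioi, prod_Ici_eq, ← Finset.prod_pow_eq_pow_sum]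
  simp only [Finset.prod_mul_distrib]
  ring

end Segments

/-! ### Translation between the hypergeometric series and the functional. -/

section Assembly

variable {s : ℕ}

theorem phiTerm_eq (n : ℕ) (k : Fin s → ℕ) {q : ℂ} (hq : q ≠ 0) (w : ℂ) (z : Fin s → ℂ) (i : ℕ) :
    phiTerm (upperParams n k q w z) (lowerParams n k q w z) q
      (-q ^ ((n : ℤ) - (∑ l, k l : ℕ) + 1)) i = baileyTerm q w n i *
    ∏ l, ((q ^ k l)⁻¹ ^ i * (qPoch (w / z l) q i * qPoch (q ^ k l * w * z l) q i /
      (qPoch (w * z l) q i * qPoch (q ^ (-(k l : ℤ)) * w / z l) q i))) := by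
  have hx : -q ^ ((n : ℤ) - (∑ l, k l : ℕ) + 1) = -q ^ (n + 1) * ∏ l, (q ^ k l)⁻¹ := by
    rw [Finset.prod_inv_distrib, Finset.prod_pow_eq_pow_sum,
      show (n : ℤ) - (∑ l, k l : ℕ) + 1 = ((n + 1 : ℕ) : ℤ) - (∑ l, k l : ℕ) by push_cast; ring,
      zpow_sub₀ hq, zpow_natCast, zpow_natCast]
    ring
  unfold phiTerm baileyTerm upperParams lowerParams
  rw [hx, Fin.prod_univ_succ, Fin.prod_univ_succ, Fin.prod_univ_succ, mul_pow]
  simp only [Fin.cons_zero, Fin.cons_succ, Fin.prod_univ_add, Fin.append_left, Fin.append_right,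
    Finset.prod_mul_distrib, Finset.prod_div_distrib, Finset.prod_pow]
  simp only [div_eq_mul_inv, mul_inv]
  ring

theorem qPoch_zpow_neg_eq_zero {q : ℂ} (hq : q ≠ 0) {n i : ℕ} (h : n < i) :
    qPoch (q ^ (-(n : ℤ))) q i = 0 := by
  refine Finset.prod_eq_zero (Finset.mem_range.2 h) ?_
  rw [← zpow_natCast, ← zpow_add₀ hq]
  simp

theorem qPoch_shift_neg {q : ℂ} (hq : q ≠ 0) (w z : ℂ) (k i : ℕ) :
    qPoch (q ^ i * (q ^ (-(k : ℤ)) * w / z)) q k =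
      ∏ j ∈ Finset.range k, (1 - q ^ i * w / (q * (z * q ^ j))) := by
  unfold qPoch
  rw [← Finset.prod_range_reflect]
  refine Finset.prod_congr rfl fun j hj => ?_
  obtain ⟨d, rfl⟩ := Nat.exists_eq_add_of_lt (Finset.mem_range.1 hj)
  rw [show j + d + 1 - 1 - j = d by omega, zpow_neg, zpow_natCast]
  field_simp
  ring

theorem one_sub_div_eq {q w z : ℂ} (hq : q ≠ 0) (hw : w ≠ 0) (hz : z ≠ 0) (n j : ℕ) :
    1 - q ^ n * w / (q * (z * q ^ j)) =
      -(q ^ n * w / (q * (z * q ^ j))) * (1 - q ^ (1 - (n : ℤ)) * z / w * q ^ j) := by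
  rw [zpow_sub₀ hq, zpow_one, zpow_natCast]
  field_simp
  ring

theorem qPoch_shift_neg_ne_zero {q w z : ℂ} (hq : q ≠ 0) (hw : w ≠ 0) (hz : z ≠ 0) {k n : ℕ}
    (h6 : qPoch (q ^ (1 - (n : ℤ)) * z / w) q k ≠ 0) :
    qPoch (q ^ n * (q ^ (-(k : ℤ)) * w / z)) q k ≠ 0 := by
  rw [qPoch_shift_neg hq, Finset.prod_ne_zero_iff]
  intro j hj
  rw [one_sub_div_eq hq hw hz]
  refine mul_ne_zero (neg_ne_zero.2 ?_) (qPoch_ne_zero_iff.1 h6 j (Finset.mem_range.1 hj))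
  exact div_ne_zero (mul_ne_zero (pow_ne_zero _ hq) hw)
    (mul_ne_zero hq (mul_ne_zero hz (pow_ne_zero _ hq)))

theorem prod_lattice_factor {q w z : ℂ} (hq : q ≠ 0) (hw : w ≠ 0) (hz : z ≠ 0) (k i : ℕ) :
    w ^ k * ∏ j ∈ Finset.range k, (latticePoint q w i - (z * q ^ j + (q * (z * q ^ j))⁻¹)) =
      (q ^ k)⁻¹ ^ i * (qPoch (q ^ i * w * z) q k * qPoch (q ^ i * (q ^ (-(k : ℤ)) * w / z)) q k) := by
  rw [qPoch_shift_neg hq, qPoch, ← Finset.prod_mul_distrib]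
  have e2 : w ^ k = ∏ _j ∈ Finset.range k, w := by simp
  have e3 : (q ^ k)⁻¹ ^ i = ∏ _j ∈ Finset.range k, (q ^ i)⁻¹ := by
    simp only [Finset.prod_const, Finset.card_range, ← inv_pow]
    rw [← pow_mul, ← pow_mul, mul_comm]
  rw [e2, e3, ← Finset.prod_mul_distrib, ← Finset.prod_mul_distrib]
  refine Finset.prod_congr rfl fun j _ => ?_
  unfold latticePoint
  field_simp
  ring

/-- Splitting (a;q)_{i+k} in both orders, for a = wz and a = q^{-k}w/z, replaces quotients of length
i by factorials of length k. Their dependence on i is polynomial in ξ_i by `prod_lattice_factor`. -/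
theorem qPoch_ratio_eq {q w z : ℂ} (hq : q ≠ 0) (hw : w ≠ 0) (hz : z ≠ 0) {k n i : ℕ} (hi : i ≤ n)
    (h3 : qPoch (w / z) q n ≠ 0) (h4 : qPoch (q ^ (-(k : ℤ)) * w / z) q n ≠ 0)
    (h5 : qPoch (w * z) q (max n k) ≠ 0)
    (hE : qPoch (q ^ n * (q ^ (-(k : ℤ)) * w / z)) q k ≠ 0) :
    qPoch (q ^ (-(k : ℤ)) * w / z) q n / qPoch (w / z) q n *
      ((q ^ k)⁻¹ ^ i * (qPoch (w / z) q i * qPoch (q ^ k * w * z) q i /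
        (qPoch (w * z) q i * qPoch (q ^ (-(k : ℤ)) * w / z) q i))) =
    w ^ k / (qPoch (w * z) q k * qPoch (q ^ n * (q ^ (-(k : ℤ)) * w / z)) q k) *
      ∏ j ∈ Finset.range k, (latticePoint q w i - (z * q ^ j + (q * (z * q ^ j))⁻¹)) := by
  have hle : ∀ {a : ℂ} {M N : ℕ}, M ≤ N → qPoch a q N ≠ 0 → qPoch a q M ≠ 0 :=
    fun hMN h => qPoch_ne_zero_iff.2 fun j hj => qPoch_ne_zero_iff.1 h j (hj.trans_le hMN)
  have h4i := hle hi h4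
  have h5i := hle (hi.trans (le_max_left n k)) h5
  have h5k := hle (le_max_right n k) h5
  have f1 : qPoch (w * z) q i * qPoch (q ^ i * w * z) q k =
      qPoch (w * z) q k * qPoch (q ^ k * w * z) q i := by
    rw [show q ^ i * w * z = w * z * q ^ i by ring, show q ^ k * w * z = w * z * q ^ k by ring,
      ← qPoch_add, ← qPoch_add, add_comm]
  have f2 : ∀ t, qPoch (q ^ (-(k : ℤ)) * w / z) q t *
      qPoch (q ^ t * (q ^ (-(k : ℤ)) * w / z)) q k =
      qPoch (q ^ (-(k : ℤ)) * w / z) q k * qPoch (w / z) q t := by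
    intro t
    have : w / z = q ^ (-(k : ℤ)) * w / z * q ^ k := by
      rw [zpow_neg, zpow_natCast]
      field_simp
    rw [mul_comm (q ^ t), ← qPoch_add]
    nth_rewrite 1 [this]
    rw [← qPoch_add, add_comm]
  have f2n := f2 n
  have f2i := f2 i
  have hE0 : qPoch (q ^ (-(k : ℤ)) * w / z) q k ≠ 0 := fun h => by
    rw [h, zero_mul] at f2n
    exact mul_ne_zero h4 hE f2n
  rw [div_mul_eq_mul_div (w ^ k), prod_lattice_factor hq hw hz]
  generalize qPoch (q ^ n * (q ^ (-(k : ℤ)) * w / z)) q k = E at *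
  generalize qPoch (q ^ i * (q ^ (-(k : ℤ)) * w / z)) q k = E' at *
  generalize qPoch (q ^ (-(k : ℤ)) * w / z) q n = A at *
  generalize qPoch (q ^ (-(k : ℤ)) * w / z) q i = A' at *
  generalize qPoch (q ^ (-(k : ℤ)) * w / z) q k = E₀ at *
  generalize qPoch (w / z) q n = B at *
  generalize qPoch (w / z) q i = B' at *
  generalize qPoch (w * z) q i = D at *
  generalize qPoch (w * z) q k = D' at *
  generalize qPoch (q ^ k * w * z) q i = F at *
  generalize qPoch (q ^ i * w * z) q k = F' at *
  generalize (q ^ k)⁻¹ ^ i = Q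
  have g : A * E * B' = A' * E' * B := by
    apply mul_left_cancel₀ hE0
    linear_combination E₀ * B' * f2n - E₀ * B * f2i
  rw [div_mul_eq_mul_div, mul_div_assoc', mul_div_assoc', div_div,
    div_eq_div_iff (mul_ne_zero (mul_ne_zero h5i h4i) h3) (mul_ne_zero h5k hE)]
  linear_combination (Q * F * D') * g - (Q * A' * B * E') * f1

/-- The normalization makes the weight of a `false` point equal to 1, so only the points j < m
contribute. -/
theorem prod_pointWeight_eq {q w z : ℂ} (hq : q ≠ 0) (hw : w ≠ 0) (hz : z ≠ 0) {k m n : ℕ}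
    (hm : m ≤ k) (h5 : qPoch (w * z) q k ≠ 0)
    (h6 : qPoch (q ^ (1 - (n : ℤ)) * z / w) q k ≠ 0) :
    (-w) ^ k / (qPoch (w * z) q k * qPoch (q ^ n * (q ^ (-(k : ℤ)) * w / z)) q k) *
      (∏ j ∈ Finset.range k, (q * (z * q ^ j))⁻¹) *
      (∏ j ∈ Finset.range k, pointWeight q (q ^ n * w) (q / w) (decide (j < m)) (z * q ^ j)) =
    (q ^ (n * m))⁻¹ * (qPoch (q ^ n * w * z) q m / qPoch (w * z) q m *
            (qPoch (q * z / w) q m / qPoch (q ^ (1 - (n : ℤ)) * z / w) q m)) := by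
  rw [qPoch_shift_neg hq]
  have e1 : ∀ j < k, (-w) / ((1 - w * z * q ^ j) * (1 - q ^ n * w / (q * (z * q ^ j)))) *
      (q * (z * q ^ j))⁻¹ * pointWeight q (q ^ n * w) (q / w) (decide (j < m)) (z * q ^ j) =
      if j < m then (q ^ n)⁻¹ * ((1 - q ^ n * w * z * q ^ j) / (1 - w * z * q ^ j) *
        ((1 - q * z / w * q ^ j) / (1 - q ^ (1 - (n : ℤ)) * z / w * q ^ j))) else 1 := by
    intro j hj
    have h7 := qPoch_ne_zero_iff.1 h5 j hj
    have h8 := qPoch_ne_zero_iff.1 h6 j hj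
    rw [one_sub_div_eq hq hw hz]
    split_ifs with hjm
    · simp only [hjm, decide_true, pointWeight]
      generalize 1 - q ^ (1 - (n : ℤ)) * z / w * q ^ j = A at *
      field_simp
    · have h9 : q ^ n * w - q * (z * q ^ j) =
          -(q * z * q ^ j) * (1 - q ^ n * w / (q * (z * q ^ j))) := by
        field_simp
        ring
      simp only [hjm, decide_false, pointWeight]
      rw [h9, one_sub_div_eq hq hw hz]
      generalize 1 - q ^ (1 - (n : ℤ)) * z / w * q ^ j = A at *
      field_simp
  have e2 : (-w) ^ k = ∏ _j ∈ Finset.range k, (-w) := by simp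
  rw [e2, qPoch, ← Finset.prod_mul_distrib, ← Finset.prod_div_distrib, ← Finset.prod_mul_distrib,
    ← Finset.prod_mul_distrib, Finset.prod_congr rfl fun j hj => e1 j (Finset.mem_range.1 hj)]
  obtain ⟨d, rfl⟩ := Nat.exists_eq_add_of_le hm
  rw [Finset.prod_range_add, Finset.prod_congr rfl fun j hj => if_pos (Finset.mem_range.1 hj),
    Finset.prod_eq_one (s := Finset.range d) fun j _ => if_neg (by omega), mul_one]
  simp only [qPoch, Finset.prod_mul_distrib, Finset.prod_div_distrib, Finset.prod_const,
    Finset.card_range]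
  rw [inv_pow, ← pow_mul]

end Assembly

/-! ### The main identity. -/

theorem theorem11 (s n : ℕ) (k : Fin s → ℕ) (hk : ∀ l, 0 < k l)
    (q w : ℂ) (z : Fin s → ℂ)
    (hq0 : q ≠ 0) (hq1 : ‖q‖ < 1)
    -- genericity of `w` and `z`: none of the denominators in the identity vanishes
    (hw : w ≠ 0) (hz : ∀ l, z l ≠ 0)
    (hzz : ∀ a b, a ≠ b → z a ≠ z b)
    (hd1 : qPoch (w ^ 2) q n ≠ 0)
    (hd2 : qPoch (q ^ n * w ^ 2) q n ≠ 0)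
    (hd3 : ∀ l, qPoch (w / z l) q n ≠ 0)
    (hd4 : ∀ l, qPoch (q ^ (-(k l : ℤ)) * w / z l) q n ≠ 0)
    (hd5 : ∀ l, qPoch (w * z l) q (max n (k l)) ≠ 0)
    (hd6 : ∀ l, qPoch (q ^ (1 - (n : ℤ)) * z l / w) q (k l) ≠ 0)
    (hd7 : ∀ a b, a ≤ b → 1 - z a * z b ≠ 0)
    (hd8 : ∀ a b, a ≤ b → qPoch (q * z a * z b) q (k a) ≠ 0)
    (hd9 : ∀ a b, qPoch (q * z a / z b) q (k a) ≠ 0)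
    (hd10 : ∀ a b, qPoch (q ^ (1 + k b) * z a * z b) q (k a) ≠ 0) :
    Summable (phiTerm (upperParams n k q w z) (lowerParams n k q w z) q
      (-q ^ ((n : ℤ) - (∑ l, k l : ℕ) + 1))) ∧
    qPoch (q * w ^ 2) (q ^ 2) n / qPoch (w ^ 2) q n *
      (∏ l, qPoch (q ^ (-(k l : ℤ)) * w / z l) q n / qPoch (w / z l) q n) *
      phi (upperParams n k q w z) (lowerParams n k q w z) q
        (-q ^ ((n : ℤ) - (∑ l, k l : ℕ) + 1)) =
    q ^ (-((∑ l, k l).choose 2 : ℤ)) * qPochInt (-q) q ((n : ℤ) - (∑ l, k l : ℕ)) *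
      (∏ a, ∏ b ∈ Finset.Ioi a,
        qPoch (q ^ (k b + 1) * z a * z b) q (k a) / qPoch (q * z a * z b) q (k a)) *
      (∏ a, qPoch (q * z a ^ 2) (q ^ 2) (k a) / qPoch (q * z a ^ 2) q (k a)) *
      ∑ m ∈ Finset.Iic k,
        (-1) ^ (∑ l, m l) * cCoeff k q z m *
          q ^ ((((∑ l, k l : ℕ) : ℤ) - n) * (∑ l, m l : ℕ)) *
          ∏ l, (qPoch (q ^ n * w * z l) q (m l) / qPoch (w * z l) q (m l)) *
            (qPoch (q * z l / w) q (m l) / qPoch (q ^ (1 - (n : ℤ)) * z l / w) q (m l)) := by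
  -- The ranges j = 0, 1 ≤ j ≤ k_a and k_a < j ≤ k_a + k_b come from `hd7`, `hd8` and `hd10`.
  have hZ' : ∀ a b, a ≤ b → ∀ j ≤ k a + k b, 1 - z a * z b * q ^ j ≠ 0 := by
    intro a b hab j hj
    rcases Nat.eq_zero_or_pos j with rfl | hj0
    · simpa using hd7 a b hab
    · rcases Nat.lt_or_ge (k a) j with h | h
      · obtain ⟨t, rfl⟩ := Nat.exists_eq_add_of_lt h
        have := qPoch_ne_zero_iff.1 (hd10 b a) t (by omega)
        rwa [show q ^ (1 + k a) * z b * z a * q ^ t = z a * z b * q ^ (k a + t + 1) by ring] at this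
      · obtain ⟨t, rfl⟩ := Nat.exists_eq_add_of_lt hj0
        have := qPoch_ne_zero_iff.1 (hd8 a b hab) t (by omega)
        rwa [show q * z a * z b * q ^ t = z a * z b * q ^ (0 + t + 1) by ring] at this
  have hZ : ∀ a b, ∀ j ≤ k a + k b, 1 - z a * z b * q ^ j ≠ 0 := by
    intro a b j hj
    rcases le_total a b with h | h
    · exact hZ' a b h j hj
    · rw [mul_comm (z a)]
      exact hZ' b a h j (by omega)
  -- The case a = b is included: it separates the points of a single progression.
  have hx' : ∀ a b, ∀ i ≤ k a, ∀ j, j < i → z a * q ^ i - z b * q ^ j ≠ 0 := by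
    intro a b i hi j hj h
    obtain ⟨t, rfl⟩ := Nat.exists_eq_add_of_lt hj
    refine qPoch_ne_zero_iff.1 (hd9 a b) t (by omega) ?_
    have h1 : z a * q ^ (j + t + 1) - z b * q ^ j =
        -(z b * q ^ j) * (1 - q * z a / z b * q ^ t) := by
      have := hz b
      field_simp
      ring
    rw [h1] at h
    exact (mul_eq_zero.1 h).resolve_left (neg_ne_zero.2 (mul_ne_zero (hz b) (pow_ne_zero _ hq0)))
  have hx : ∀ a b, a ≠ b → ∀ i ≤ k a, ∀ j ≤ k b, z a * q ^ i - z b * q ^ j ≠ 0 := by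
    intro a b hab i hi j hj
    rcases lt_trichotomy i j with h | rfl | h
    · rw [← neg_sub]
      exact neg_ne_zero.2 (hx' b a j hj i h)
    · rw [← sub_mul]
      exact mul_ne_zero (sub_ne_zero.2 (hzz a b hab)) (pow_ne_zero _ hq0)
    · exact hx' a b i hi j h
  have hgen : Generic q (segmentVar q z) (segmentSet k) := by
    refine ⟨fun p _ => mul_ne_zero (hz _) (pow_ne_zero _ hq0), fun p hp p' hp' hne => ?_,
      fun p hp p' hp' => ?_⟩
    · obtain ⟨⟨a, i⟩, rfl⟩ := toLex.surjective p
      obtain ⟨⟨b, j⟩, rfl⟩ := toLex.surjective p'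
      have hi := mem_segmentSet.1 hp
      have hj := mem_segmentSet.1 hp'
      apply sub_ne_zero.1
      simp only [segmentVar, ofLex_toLex]
      by_cases hab : a = b
      · subst hab
        rcases lt_trichotomy i j with h | rfl | h
        · rw [← neg_sub]
          exact neg_ne_zero.2 (hx' a a j hj.le i h)
        · exact absurd rfl hne
        · exact hx' a a i hi.le j h
      · exact hx a b hab i hi.le j hj.le
    · obtain ⟨⟨a, i⟩, rfl⟩ := toLex.surjective p
      obtain ⟨⟨b, j⟩, rfl⟩ := toLex.surjective p'
      have hi := mem_segmentSet.1 hp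
      have hj := mem_segmentSet.1 hp'
      have := hZ a b (i + j + 1) (by omega)
      simp only [segmentVar, ofLex_toLex]
      rwa [show q * (z a * q ^ i) * (z b * q ^ j) = z a * z b * q ^ (i + j + 1) by ring]
  have hw2 : ∀ j < 2 * n, 1 - w ^ 2 * q ^ j ≠ 0 := by
    intro j hj
    rcases Nat.lt_or_ge j n with h | h
    · exact qPoch_ne_zero_iff.1 hd1 j h
    · obtain ⟨t, rfl⟩ := Nat.exists_eq_add_of_le h
      have := qPoch_ne_zero_iff.1 hd2 t (by omega)
      rwa [show q ^ n * w ^ 2 * q ^ t = w ^ 2 * q ^ (n + t) by ring] at this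
  have hzero : ∀ i ∉ Finset.range (n + 1), phiTerm (upperParams n k q w z)
      (lowerParams n k q w z) q (-q ^ ((n : ℤ) - (∑ l, k l : ℕ) + 1)) i = 0 := by
    intro i hi
    rw [phiTerm_eq n k hq0, baileyTerm, qPoch_zpow_neg_eq_zero hq0 (by simpa using hi)]
    simp
  refine ⟨summable_of_ne_finset_zero hzero, ?_⟩
  have hE := fun l => qPoch_shift_neg_ne_zero hq0 hw (hz l) (hd6 l)
  have h5k : ∀ l, qPoch (w * z l) q (k l) ≠ 0 := fun l => qPoch_ne_zero_iff.2 fun j hj =>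
    qPoch_ne_zero_iff.1 (hd5 l) j (hj.trans_le (le_max_right _ _))
  set D : Fin s → ℂ := fun l =>
    qPoch (w * z l) q (k l) * qPoch (q ^ n * (q ^ (-(k l : ℤ)) * w / z l)) q (k l) with hD
  have hleft : qPoch (q * w ^ 2) (q ^ 2) n / qPoch (w ^ 2) q n *
      (∏ l, qPoch (q ^ (-(k l : ℤ)) * w / z l) q n / qPoch (w / z l) q n) *
      phi (upperParams n k q w z) (lowerParams n k q w z) q
        (-q ^ ((n : ℤ) - (∑ l, k l : ℕ) + 1)) =
      (∏ l, w ^ k l / D l) * baileyFunctional q w n (fun ξ => ∏ t ∈ segmentSet k,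
        (ξ - (segmentVar q z t + (q * segmentVar q z t)⁻¹))) := by
    rw [phi, tsum_eq_sum hzero, baileyFunctional, mul_assoc, mul_left_comm (∏ l, w ^ k l / D l)]
    congr 1
    rw [Finset.mul_sum, Finset.mul_sum]
    refine Finset.sum_congr rfl fun i hi => ?_
    rw [phiTerm_eq n k hq0, mul_left_comm, mul_left_comm (∏ l, w ^ k l / D l),
      ← Finset.prod_mul_distrib, prod_segmentSet, ← Finset.prod_mul_distrib]
    congr 1
    refine Finset.prod_congr rfl fun l _ => ?_
    rw [qPoch_ratio_eq hq0 hw (hz l) (by simpa [Nat.lt_succ_iff] using hi) (hd3 l) (hd4 l) (hd5 l)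
      (hE l)]
    rfl
  rw [hleft, baileyFunctional_prod hq0 hq1 hw hw2 hgen, typeCSum, signSum_segmentSet,
    card_segmentSet, prod_segmentSet, Finset.mul_sum, Finset.mul_sum, Finset.mul_sum]
  refine Finset.sum_congr rfl fun m hm => ?_
  have hm' : m ≤ k := Finset.mem_Iic.1 hm
  rw [prod_signWeight_segments hq0 hq1 hz hm' hZ hx]
  have hpt : (∏ l, w ^ k l / D l) * (-1) ^ (∑ l, k l) *
      (∏ l, ∏ j ∈ Finset.range (k l), (q * segmentVar q z (toLex (l, j)))⁻¹) *
      (∏ l, ∏ j ∈ Finset.range (k l), pointWeight q (q ^ n * w) (q / w) (decide (j < m l))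
        (segmentVar q z (toLex (l, j)))) =
      (q ^ (n * ∑ l, m l))⁻¹ * ∏ l, (qPoch (q ^ n * w * z l) q (m l) / qPoch (w * z l) q (m l) *
        (qPoch (q * z l / w) q (m l) / qPoch (q ^ (1 - (n : ℤ)) * z l / w) q (m l))) := by
    rw [Finset.mul_sum, ← Finset.prod_pow_eq_pow_sum, ← Finset.prod_pow_eq_pow_sum,
      ← Finset.prod_inv_distrib, ← Finset.prod_mul_distrib, ← Finset.prod_mul_distrib,
      ← Finset.prod_mul_distrib, ← Finset.prod_mul_distrib]
    refine Finset.prod_congr rfl fun l _ => ?_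
    rw [← prod_pointWeight_eq hq0 hw (hz l) (hm' l) (h5k l) (hd6 l), neg_eq_neg_one_mul w, mul_pow]
    simp only [segmentVar, ofLex_toLex, hD]
    ring
  -- The power of q has two sources: |k||m| from the pair weights and -n|m| from the one-point
  -- weights.
  have hq2 : q ^ ((((∑ l, k l : ℕ) : ℤ) - n) * (∑ l, m l : ℕ)) =
      q ^ ((∑ l, k l) * ∑ l, m l) * (q ^ (n * ∑ l, m l))⁻¹ := by
    rw [sub_mul, zpow_sub₀ hq0, ← Nat.cast_mul, ← Nat.cast_mul, zpow_natCast, zpow_natCast,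
      div_eq_mul_inv]
  rw [hq2, zpow_neg, zpow_natCast]
  linear_combination (qPochInt (-q) q ((n : ℤ) - (∑ l, k l : ℕ)) *
    (q ^ (∑ l, k l).choose 2)⁻¹ * ((∏ a, ∏ b ∈ Finset.Ioi a,
        qPoch (q ^ (k b + 1) * z a * z b) q (k a) / qPoch (q * z a * z b) q (k a)) *
      (∏ a, qPoch (q * z a ^ 2) (q ^ 2) (k a) / qPoch (q * z a ^ 2) q (k a)) *
      ((-1) ^ (∑ l, m l) * q ^ ((∑ l, k l) * ∑ l, m l)) * cCoeff k q z m)) * hpt
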